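/- For integers $n\ge 1$, $t\ge 0$, let $S^{n-1}$ be the unit sphere of $\mathbb R^n$ with surface measure $\sigma$ (counting measure on $S^0=\{\pm1\}$ if $n=1$). A *cubature measure of strength $t$* on $S^{n-1}$ is a probability measure $\nu=\sum_i\nu_i\delta_{\xi_i}$ on $S^{n-1}$ supported on countably many points (the $\xi_i$ distinct, all $\nu_i>0$) such that $\int f\,d\nu=\frac1{\sigma(S^{n-1})}\int_{S^{n-1}} f\,d\sigma$ for every real polynomial $f$ on $\mathbb R^n$ of degree at most $t$. For $0\le\theta<1$ put $\|\nu\|_\theta=\sum_i\nu_i^\theta\in[0,\infty]$ (so $\|\nu\|_0$ is the number of points in the support), and let $\Theta(t,\theta,n)$ be the infimum of $\|\nu\|_\theta$ over all cubature measures $\nu$ of strength $t$ on $S^{n-1}$. (a) For every integer $t\ge 0$ there exist constants $c,C>0$, depending only on $t$, such that for all integers $n\ge1$ and all $\theta\in[0,1)$ $$\bigl(c\,n^{\lfloor t/2\rfloor}\bigr)^{1-\theta}\le\Theta(t,\theta,n),$$ and, if $t\ge2$, also $$\Theta(t,\theta,n)\le\bigl(C\,n^{2\lfloor t/2\rfloor-1}\bigr)^{1-\theta}.$$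 (b) For every integer $n\ge1$ there exist constants $c,C>0$, depending only on $n$, such that for all integers $t\ge1$ and all $\theta\in[0,1)$ $$\bigl(c\,t^{\,n-1}\bigr)^{1-\theta}\le\Theta(t,\theta,n)\le\bigl(C\,t^{\,n-1}\bigr)^{1-\theta}.$$ -/

import Mathlib

open MeasureTheory
open scoped ENNReal

noncomputable section

namespace SphericalCubature

/-- The unit sphere `S^{n-1}` of `ℝ^n`. -/
abbrev S (n : ℕ) : Type := Metric.sphere (0 : EuclideanSpace ℝ (Fin n)) 1

/-- Surface measure on `S^{n-1}`, not normalized (counting measure on the two points if `n = 1`). -/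
def sigma (n : ℕ) : Measure (S n) :=
  (volume : Measure (EuclideanSpace ℝ (Fin n))).toSphere

/-- The function on the sphere given by a real polynomial in `n` variables. -/
def polyFun {n : ℕ} (p : MvPolynomial (Fin n) ℝ) (x : S n) : ℝ :=
  MvPolynomial.eval (fun i => (x : EuclideanSpace ℝ (Fin n)) i) p

/-- `ν` is a discrete probability measure: it is carried by a countable set of points. -/
def IsDiscreteProbability {n : ℕ} (ν : Measure (S n)) : Prop :=
  IsProbabilityMeasure ν ∧ ∃ A : Set (S n), A.Countable ∧ ν Aᶜ = 0

/-- The cubature measures of strength `t` on `S^{n-1}`: the discrete probability measures whose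
integral against each polynomial of degree at most `t` is the mean value of that polynomial
over the sphere. -/
def cubatureMeasures (t n : ℕ) : Set (Measure (S n)) :=
  {ν | IsDiscreteProbability ν ∧ ∀ p : MvPolynomial (Fin n) ℝ, p.totalDegree ≤ t →
    ∫ x, polyFun p x ∂ν = ⨍ x, polyFun p x ∂(sigma n)}

/-- `‖ν‖_θ = ∑ ν_i ^ θ`, the sum over the atoms (points of positive mass) of `ν`,
with values in `[0, ∞]`. For `θ = 0` it is the number of atoms. -/
def thetaNorm {n : ℕ} (θ : ℝ) (ν : Measure (S n)) : ℝ≥0∞ :=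
  ∑' x : {x : S n // ν {x} ≠ 0}, (ν {x.1}) ^ θ

/-- `Θ(t, θ, n)`, the infimum of `‖ν‖_θ` over cubature measures `ν` of strength `t` on `S^{n-1}`. -/
def Theta (t : ℕ) (θ : ℝ) (n : ℕ) : ℝ≥0∞ :=
  ⨅ ν ∈ cubatureMeasures t n, thetaNorm θ ν

end SphericalCubature

end

noncomputable section

namespace SphericalCubature

section Polynomials

open MvPolynomial

/-! ### Polynomial functions and the normalized surface measure -/

/-! Lower bounds. Put `e = t / 2` and let `N = n.multichoose e` be the dimension of the space of
homogeneous polynomials of degree `e`. By rotation invariance its reproducing kernel in L² of the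
normalized sphere equals `N` on the diagonal. The square of the kernel at `x` has degree at most
`t`, so cubature gives `ν {x} * N ^ 2 ≤ N`: every atom has mass at most `1 / N`
(`measure_singleton_le`). Summing `a ^ θ ≥ N ^ (1 - θ) * a` over the atoms gives `rpow_le_Theta`.

Upper bounds. By the power mean inequality, `N` nodes give a norm of at most `N ^ (1 - θ)`
(`thetaNorm_pointMasses_le`), so only nodes need counting. For fixed `n`, Carathéodory's theorem
applied to the monomials of degrees `t` and `t - 1` suffices (`exists_quadrature`).

For fixed `t`, put `k = t / 2`. In degree `2 * k` the moments of the sphere are proportional to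
those of a product Gaussian. A one-dimensional Gaussian has an equal-weight quadrature with a prime
number `p` of nodes (`exists_equal_weight_quadrature`). An orthogonal array of strength `2 * k` over
`p` letters, with `O(n ^ (2 * k - 1))` words (`exists_orthogonal_array`), replaces the full product
grid, since a monomial of degree `2 * k` sees at most `2 * k` coordinates. Radial projection with
weights `‖x‖ ^ (2 * k)` and antipodal symmetrization yield the cubature measure. -/

lemma continuous_polyFun {n : ℕ} (p : MvPolynomial (Fin n) ℝ) :
    Continuous (polyFun (n := n) p) := by
  have h : Continuous fun x : S n => fun i => (x : EuclideanSpace ℝ (Fin n)) i := by fun_prop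
  exact (MvPolynomial.continuous_eval p).comp h

lemma integrable_of_continuous {n : ℕ} (ν : Measure (S n)) [IsFiniteMeasure ν] {f : S n → ℝ}
    (hf : Continuous f) : Integrable f ν :=
  hf.integrable_of_hasCompactSupport (HasCompactSupport.of_compactSpace f)

lemma integrable_polyFun {n : ℕ} (ν : Measure (S n)) [IsFiniteMeasure ν]
    (p : MvPolynomial (Fin n) ℝ) : Integrable (polyFun p) ν :=
  integrable_of_continuous ν (continuous_polyFun p)

lemma polyFun_add {n : ℕ} (p q : MvPolynomial (Fin n) ℝ) (x : S n) :
    polyFun (p + q) x = polyFun p x + polyFun q x := by simp [polyFun]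

lemma polyFun_mul {n : ℕ} (p q : MvPolynomial (Fin n) ℝ) (x : S n) :
    polyFun (p * q) x = polyFun p x * polyFun q x := by simp [polyFun]

lemma polyFun_smul {n : ℕ} (a : ℝ) (p : MvPolynomial (Fin n) ℝ) (x : S n) :
    polyFun (a • p) x = a * polyFun p x := by simp [polyFun, MvPolynomial.smul_eval]

lemma polyFun_sum {n : ℕ} {ι : Type*} (s : Finset ι) (p : ι → MvPolynomial (Fin n) ℝ) (x : S n) :
    polyFun (∑ i ∈ s, p i) x = ∑ i ∈ s, polyFun (p i) x := by simp [polyFun]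

instance isFiniteMeasure_sigma (n : ℕ) : IsFiniteMeasure (sigma n) := by
  unfold sigma; infer_instance

instance isOpenPosMeasure_sigma (n : ℕ) : (sigma n).IsOpenPosMeasure := by
  unfold sigma; infer_instance

lemma nontrivial_euclideanSpace {n : ℕ} (hn : 1 ≤ n) :
    Nontrivial (EuclideanSpace ℝ (Fin n)) := by
  have : Nonempty (Fin n) := ⟨⟨0, hn⟩⟩
  infer_instance

lemma nonempty_sphere {n : ℕ} (hn : 1 ≤ n) : Nonempty (S n) := by
  have := nontrivial_euclideanSpace hn
  exact (NormedSpace.sphere_nonempty.2 zero_le_one).to_subtype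

lemma sigma_ne_zero {n : ℕ} (hn : 1 ≤ n) : sigma n ≠ 0 := by
  have := nontrivial_euclideanSpace hn
  exact Measure.toSphere_ne_zero _

/-- The normalized surface measure. -/
def mu (n : ℕ) : Measure (S n) := (sigma n Set.univ)⁻¹ • sigma n

lemma average_sigma {n : ℕ} (f : S n → ℝ) : ⨍ x, f x ∂(sigma n) = ∫ x, f x ∂(mu n) := rfl

lemma isProbabilityMeasure_mu {n : ℕ} (hn : 1 ≤ n) : IsProbabilityMeasure (mu n) := by
  have : NeZero (sigma n) := ⟨sigma_ne_zero hn⟩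
  unfold mu; infer_instance

instance isFiniteMeasure_mu (n : ℕ) : IsFiniteMeasure (mu n) := by
  unfold mu; infer_instance

instance isOpenPosMeasure_mu (n : ℕ) : (mu n).IsOpenPosMeasure :=
  Measure.isOpenPosMeasure_smul _ (ENNReal.inv_ne_zero.2 (measure_ne_top _ _))

/-- The action of a linear isometry on the sphere. -/
def sphereMap {n : ℕ} (L : EuclideanSpace ℝ (Fin n) ≃ₗᵢ[ℝ] EuclideanSpace ℝ (Fin n)) (x : S n) :
    S n :=
  ⟨L x, by simp⟩

lemma continuous_sphereMap {n : ℕ}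
    (L : EuclideanSpace ℝ (Fin n) ≃ₗᵢ[ℝ] EuclideanSpace ℝ (Fin n)) : Continuous (sphereMap L) :=
  (L.continuous.comp continuous_subtype_val).subtype_mk _

-- `toSphere` measures a set through the volume of the cone over it; an isometry maps cones to cones
-- and preserves volume.
open scoped Pointwise in
lemma measurePreserving_sphereMap {n : ℕ}
    (L : EuclideanSpace ℝ (Fin n) ≃ₗᵢ[ℝ] EuclideanSpace ℝ (Fin n)) :
    MeasurePreserving (sphereMap L) (sigma n) (sigma n) := by
  refine ⟨(continuous_sphereMap L).measurable, ?_⟩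
  ext s hs
  rw [Measure.map_apply (continuous_sphereMap L).measurable hs]
  unfold sigma
  rw [Measure.toSphere_apply' _ hs,
    Measure.toSphere_apply' _ ((continuous_sphereMap L).measurable hs)]
  congr 1
  have : Set.Ioo (0 : ℝ) 1 • (Subtype.val '' (sphereMap L ⁻¹' s)) =
      L ⁻¹' (Set.Ioo (0 : ℝ) 1 • (Subtype.val '' s)) := by
    ext y
    simp only [Set.mem_smul, Set.mem_image, Set.mem_preimage]
    constructor
    · rintro ⟨r, hr, _, ⟨x, hx, rfl⟩, rfl⟩
      exact ⟨r, hr, _, ⟨_, hx, rfl⟩, by simp [sphereMap]⟩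
    · rintro ⟨r, hr, _, ⟨x, hx, rfl⟩, h⟩
      refine ⟨r, hr, _, ⟨sphereMap L.symm x, ?_, rfl⟩, ?_⟩
      · convert hx
        simp [sphereMap]
      · simp [sphereMap, ← map_smul, h]
  rw [this]
  exact (show MeasurePreserving L.toHomeomorph.toMeasurableEquiv volume volume from
    L.measurePreserving).measure_preimage_equiv _

lemma integral_comp_sphereMap {n : ℕ}
    (L : EuclideanSpace ℝ (Fin n) ≃ₗᵢ[ℝ] EuclideanSpace ℝ (Fin n)) {f : S n → ℝ}
    (hf : Continuous f) : ∫ x, f (sphereMap L x) ∂(mu n) = ∫ x, f x ∂(mu n) := by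
  have h : MeasurePreserving (sphereMap L) (mu n) (mu n) :=
    (measurePreserving_sphereMap L).smul_measure _
  rw [← integral_map h.measurable.aemeasurable (by
    rw [h.map_eq]; exact hf.aestronglyMeasurable), h.map_eq]

/-- The reflection in the hyperplane orthogonal to `x - y` swaps the two unit vectors. -/
lemma exists_sphereMap_eq {n : ℕ} (x y : S n) :
    ∃ L : EuclideanSpace ℝ (Fin n) ≃ₗᵢ[ℝ] EuclideanSpace ℝ (Fin n), sphereMap L x = y :=
  ⟨_, Subtype.ext (Submodule.reflection_sub (v := (x : EuclideanSpace ℝ (Fin n))) (w := y)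
    (by simp))⟩

/-! ### Homogeneous polynomials -/

/-- The exponents of the monomials of degree `e`. -/
def exponents (n e : ℕ) : Finset (Fin n →₀ ℕ) := Finset.univ.finsuppAntidiag e

lemma mem_exponents {n e : ℕ} {β : Fin n →₀ ℕ} : β ∈ exponents n e ↔ β.degree = e := by
  simp [exponents, Finset.mem_finsuppAntidiag, Finsupp.degree_eq_sum]

lemma card_exponents (n e : ℕ) : (exponents n e).card = n.multichoose e := by
  simp [exponents, Finset.card_finsuppAntidiag_nat_eq_multichoose]

lemma degree_of_mem_support {σ : Type*} {p : MvPolynomial σ ℝ} {e : ℕ} (hp : p.IsHomogeneous e)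
    {β : σ →₀ ℕ} (hβ : β ∈ p.support) : β.degree = e := by
  rw [Finsupp.degree_eq_weight_one]
  exact hp (mem_support_iff.1 hβ)

lemma homogeneousSubmodule_eq_span (n e : ℕ) : homogeneousSubmodule (Fin n) ℝ e =
    Submodule.span ℝ (Set.range fun β : exponents n e => monomial β.1 (1 : ℝ)) := by
  apply le_antisymm
  · intro p hp
    rw [mem_homogeneousSubmodule] at hp
    rw [p.as_sum]
    refine Submodule.sum_mem _ fun β hβ => ?_
    have hβ' : β ∈ exponents n e := mem_exponents.2 (degree_of_mem_support hp hβ)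
    have : monomial β (coeff β p) = coeff β p • monomial β (1 : ℝ) := by
      rw [smul_monomial, smul_eq_mul, mul_one]
    rw [this]
    exact Submodule.smul_mem _ _ (Submodule.subset_span ⟨⟨β, hβ'⟩, rfl⟩)
  · rw [Submodule.span_le]
    rintro _ ⟨β, rfl⟩
    exact isHomogeneous_monomial _ (mem_exponents.1 β.2)

instance finiteDimensional_homogeneousSubmodule (n e : ℕ) :
    FiniteDimensional ℝ (homogeneousSubmodule (Fin n) ℝ e) := by
  rw [homogeneousSubmodule_eq_span]
  exact FiniteDimensional.span_of_finite ℝ (Set.finite_range _)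

lemma finrank_homogeneousSubmodule (n e : ℕ) :
    Module.finrank ℝ (homogeneousSubmodule (Fin n) ℝ e) = n.multichoose e := by
  have : LinearIndependent ℝ fun β : exponents n e => monomial β.1 (1 : ℝ) := by
    have := (basisMonomials (Fin n) ℝ).linearIndependent.comp
      (fun β : exponents n e => β.1) Subtype.val_injective
    simpa [Function.comp_def] using this
  rw [homogeneousSubmodule_eq_span, finrank_span_eq_card this, Fintype.card_coe, card_exponents]

lemma eval_smul_of_isHomogeneous {σ : Type*} {p : MvPolynomial σ ℝ} {e : ℕ}
    (hp : p.IsHomogeneous e) (r : ℝ) (x : σ → ℝ) :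
    eval (fun i => r * x i) p = r ^ e * eval x p := by
  rw [eval_eq, eval_eq, Finset.mul_sum]
  refine Finset.sum_congr rfl fun β hβ => ?_
  rw [← degree_of_mem_support hp hβ, Finsupp.degree_apply]
  simp only [mul_pow, Finset.prod_mul_distrib, Finset.prod_pow_eq_pow_sum]
  ring

/-- A vector is its norm times a unit vector. -/
lemma exists_sphere_smul {n : ℕ} (hn : 1 ≤ n) (x : EuclideanSpace ℝ (Fin n)) :
    ∃ u : S n, x = ‖x‖ • (u : EuclideanSpace ℝ (Fin n)) := by
  by_cases hx : x = 0
  · obtain ⟨u⟩ := nonempty_sphere hn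
    exact ⟨u, by simp [hx]⟩
  · have h : ‖x‖ ≠ 0 := norm_ne_zero_iff.2 hx
    exact ⟨⟨‖x‖⁻¹ • x, by simp [norm_smul, h]⟩, by simp [smul_smul, h]⟩

/-- Homogeneity propagates the vanishing along rays; without it `1 - normSq n` would be a
counterexample. This makes the L² form definite. -/
lemma eq_zero_of_polyFun_eq_zero {n : ℕ} (hn : 1 ≤ n) {p : MvPolynomial (Fin n) ℝ} {e : ℕ}
    (hp : p.IsHomogeneous e) (h : ∀ x, polyFun p x = 0) : p = 0 := by
  refine hp.eq_zero_of_forall_eval_eq_zero fun y => ?_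
  obtain ⟨u, hu⟩ := exists_sphere_smul hn (WithLp.toLp 2 y)
  have : y = fun i => ‖WithLp.toLp 2 y‖ * (u : EuclideanSpace ℝ (Fin n)) i := by
    ext i
    exact congrArg (fun z : EuclideanSpace ℝ (Fin n) => z i) hu
  rw [this, eval_smul_of_isHomogeneous hp]
  exact mul_eq_zero_of_right _ (h u)

/-- The composition of a polynomial with a linear map. -/
def compLin {n : ℕ} (L : EuclideanSpace ℝ (Fin n) ≃ₗᵢ[ℝ] EuclideanSpace ℝ (Fin n))
    (p : MvPolynomial (Fin n) ℝ) : MvPolynomial (Fin n) ℝ :=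
  aeval (fun i => ∑ j, C (L (EuclideanSpace.single j 1) i) * X j) p

lemma polyFun_compLin {n : ℕ} (L : EuclideanSpace ℝ (Fin n) ≃ₗᵢ[ℝ] EuclideanSpace ℝ (Fin n))
    (p : MvPolynomial (Fin n) ℝ) (x : S n) :
    polyFun (compLin L p) x = polyFun p (sphereMap L x) := by
  have key : ∀ i, (L x : EuclideanSpace ℝ (Fin n)) i =
      ∑ j, L (EuclideanSpace.single j 1) i * (x : EuclideanSpace ℝ (Fin n)) j := by
    intro i
    have hx : (x : EuclideanSpace ℝ (Fin n)) =
        ∑ j, (x : EuclideanSpace ℝ (Fin n)) j • EuclideanSpace.single j (1 : ℝ) := by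
      ext k
      simp [Finset.sum_apply, Pi.single_apply]
    conv_lhs => rw [hx, map_sum]
    simp [mul_comm]
  unfold polyFun compLin
  rw [← coe_aeval_eq_eval, ← coe_aeval_eq_eval]
  change aeval _ (aeval _ p) = aeval _ p
  rw [comp_aeval_apply]
  congr 2
  funext i
  simp [sphereMap, key]

lemma isHomogeneous_compLin {n : ℕ}
    (L : EuclideanSpace ℝ (Fin n) ≃ₗᵢ[ℝ] EuclideanSpace ℝ (Fin n))
    {p : MvPolynomial (Fin n) ℝ} {e : ℕ} (hp : p.IsHomogeneous e) :
    (compLin L p).IsHomogeneous e := by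
  have := hp.aeval (fun i => ∑ j, C (L (EuclideanSpace.single j 1) i) * X j) (n := 1) fun i =>
    IsHomogeneous.sum _ _ _ fun j _ => by
      simpa using (isHomogeneous_C _ _).mul (isHomogeneous_X ℝ j)
  rwa [one_mul] at this

end Polynomials

section LowerBound

open MvPolynomial

/-! ### The lower bound -/

lemma exists_orthonormal_basis {V : Type*} [AddCommGroup V] [Module ℝ V] [FiniteDimensional ℝ V]
    (B : V → V → ℝ) (hsymm : ∀ p q, B p q = B q p)
    (hadd : ∀ p q r, B (p + q) r = B p r + B q r) (hsmul : ∀ (a : ℝ) p q, B (a • p) q = a * B p q)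
    (hnonneg : ∀ p, 0 ≤ B p p) (hdef : ∀ p, B p p = 0 → p = 0) :
    ∃ b : Module.Basis (Fin (Module.finrank ℝ V)) ℝ V,
      ∀ i j, B (b i) (b j) = if i = j then 1 else 0 := by
  let core : InnerProductSpace.Core ℝ V :=
    { inner := B
      conj_inner_symm := fun x y => by simpa using hsymm y x
      re_inner_nonneg := fun x => by simpa using hnonneg x
      add_left := hadd
      smul_left := fun x y r => by simpa using hsmul r x y
      definite := hdef }
  let _ : NormedAddCommGroup V := core.toNormedAddCommGroup
  let _ : InnerProductSpace ℝ V := InnerProductSpace.ofCore core.toCore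
  refine ⟨(stdOrthonormalBasis ℝ V).toBasis, fun i j => ?_⟩
  have := orthonormal_iff_ite.1 (stdOrthonormalBasis ℝ V).orthonormal i j
  rw [← this]
  simp only [OrthonormalBasis.coe_toBasis]
  rfl

/-- The homogeneous polynomials of degree `e` have an orthonormal basis in `L²` of the sphere. -/
lemma exists_homogeneous_orthonormal {n : ℕ} (hn : 1 ≤ n) (e : ℕ) :
    ∃ b : Module.Basis (Fin (n.multichoose e)) ℝ (homogeneousSubmodule (Fin n) ℝ e),
      ∀ i j, ∫ x, polyFun (b i).1 x * polyFun (b j).1 x ∂(mu n) = if i = j then 1 else 0 := by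
  have hint : ∀ p q : MvPolynomial (Fin n) ℝ,
      Integrable (fun x => polyFun p x * polyFun q x) (mu n) := fun p q =>
    integrable_of_continuous _ ((continuous_polyFun p).mul (continuous_polyFun q))
  obtain ⟨b, hb⟩ := exists_orthonormal_basis (V := homogeneousSubmodule (Fin n) ℝ e)
    (fun p q => ∫ x, polyFun p.1 x * polyFun q.1 x ∂(mu n))
    (fun p q => by simp only [mul_comm])
    (fun p q r => by
      rw [← integral_add (hint _ _) (hint _ _)]
      simp only [Submodule.coe_add, polyFun_add, add_mul])
    (fun a p q => by
      rw [← integral_const_mul]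
      simp only [Submodule.coe_smul, polyFun_smul, mul_assoc])
    (fun p => integral_nonneg fun x => mul_self_nonneg _)
    (fun p hp => by
      rw [integral_eq_zero_iff_of_nonneg (fun x => mul_self_nonneg _) (hint _ _)] at hp
      have hp' := Measure.eq_of_ae_eq hp
        ((continuous_polyFun p.1).mul (continuous_polyFun p.1)) continuous_const
      refine Subtype.ext (eq_zero_of_polyFun_eq_zero hn p.2 fun x => ?_)
      exact mul_self_eq_zero.1 (congrFun hp' x))
  refine ⟨b.reindex (finCongr (finrank_homogeneousSubmodule n e)), fun i j => ?_⟩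
  simp only [Module.Basis.reindex_apply, hb]
  simp

lemma integral_sum_mul_sum {n N : ℕ} (f : Fin N → S n → ℝ) (hf : ∀ i, Continuous (f i))
    (hb : ∀ i j, ∫ x, f i x * f j x ∂(mu n) = if i = j then 1 else 0) (a c : Fin N → ℝ) :
    ∫ x, (∑ i, a i * f i x) * (∑ j, c j * f j x) ∂(mu n) = ∑ i, a i * c i := by
  have hint : ∀ i j, Integrable (fun x => a i * c j * (f i x * f j x)) (mu n) := fun i j =>
    (integrable_of_continuous _ ((hf i).mul (hf j))).const_mul _
  have h : ∀ x, (∑ i, a i * f i x) * (∑ j, c j * f j x) =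
      ∑ i, ∑ j, a i * c j * (f i x * f j x) := by
    intro x
    rw [Finset.sum_mul_sum]
    exact Finset.sum_congr rfl fun i _ => Finset.sum_congr rfl fun j _ => by ring
  simp only [h]
  rw [integral_finsetSum _ fun i _ => integrable_finsetSum _ fun j _ => hint i j]
  refine Finset.sum_congr rfl fun i _ => ?_
  rw [integral_finsetSum _ fun j _ => hint i j]
  simp [integral_const_mul, hb]

/-- The reproducing kernel of the homogeneous polynomials is constant on the diagonal. -/
lemma sum_sq_orthonormal {n : ℕ} (hn : 1 ≤ n) {e N : ℕ}
    (b : Module.Basis (Fin N) ℝ (homogeneousSubmodule (Fin n) ℝ e))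
    (hb : ∀ i j, ∫ x, polyFun (b i).1 x * polyFun (b j).1 x ∂(mu n) = if i = j then 1 else 0)
    (x : S n) : ∑ i, polyFun (b i).1 x ^ 2 = N := by
  have := isProbabilityMeasure_mu hn
  have hint : ∀ p q : MvPolynomial (Fin n) ℝ,
      Integrable (fun x => polyFun p x * polyFun q x) (mu n) := fun p q =>
    integrable_of_continuous _ ((continuous_polyFun p).mul (continuous_polyFun q))
  -- An isometry acts on the orthonormal basis by a matrix `A`, orthogonal because `mu n` is
  -- invariant, so the sum of squares does not change. Isometries act transitively, hence the sum is
  -- constant.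
  have hinv : ∀ y, ∑ i, polyFun (b i).1 y ^ 2 = ∑ i, polyFun (b i).1 x ^ 2 := by
    intro y
    obtain ⟨L, rfl⟩ := exists_sphereMap_eq x y
    let q : Fin N → homogeneousSubmodule (Fin n) ℝ e := fun i =>
      ⟨compLin L (b i).1, isHomogeneous_compLin L (b i).2⟩
    let A : Matrix (Fin N) (Fin N) ℝ := fun i j => b.repr (q i) j
    have hq : ∀ i z, polyFun (b i).1 (sphereMap L z) = ∑ j, A i j * polyFun (b j).1 z := by
      intro i z
      rw [← polyFun_compLin]
      have h := congrArg Subtype.val (b.sum_repr (q i))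
      simp only [AddSubmonoidClass.coe_finsetSum, Submodule.coe_smul] at h
      change polyFun (q i).1 z = _
      rw [← h, polyFun_sum]
      simp only [polyFun_smul]
      rfl
    have hA : A * A.transpose = 1 := by
      ext i j
      have h1 : ∫ z, polyFun (b i).1 (sphereMap L z) * polyFun (b j).1 (sphereMap L z) ∂(mu n) =
          if i = j then 1 else 0 := by
        rw [← hb i j]
        exact integral_comp_sphereMap L
          ((continuous_polyFun (b i).1).mul (continuous_polyFun (b j).1))
      rw [Matrix.one_apply, ← h1]
      simp only [hq]
      rw [integral_sum_mul_sum _ (fun k => continuous_polyFun (b k).1) hb, Matrix.mul_apply]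
      rfl
    have hA' : A.transpose * A = 1 := mul_eq_one_comm.1 hA
    have hA'' : ∀ j k, ∑ i, A i j * A i k = if j = k then 1 else 0 := by
      intro j k
      have := congrFun (congrFun hA' j) k
      simpa [Matrix.mul_apply, Matrix.one_apply] using this
    simp only [hq, sq, Finset.sum_mul_sum]
    rw [Finset.sum_comm]
    refine Finset.sum_congr rfl fun j _ => ?_
    rw [Finset.sum_comm]
    have h : ∀ k i, A i j * polyFun (b j).1 x * (A i k * polyFun (b k).1 x) =
        A i j * A i k * (polyFun (b j).1 x * polyFun (b k).1 x) := fun k i => by ring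
    simp only [h, ← Finset.sum_mul, hA'']
    simp
  have h1 : ∫ y, ∑ i, polyFun (b i).1 y ^ 2 ∂(mu n) = N := by
    simp only [sq]
    rw [integral_finsetSum _ fun i _ => hint _ _]
    simp [hb]
  simpa [hinv] using h1

/-- An atom of a cubature measure of strength `2 * e` has mass at most the inverse of the dimension
of the space of homogeneous polynomials of degree `e`. -/
lemma measure_singleton_le {t n : ℕ} (hn : 1 ≤ n) {ν : Measure (S n)}
    (hν : ν ∈ cubatureMeasures t n) (x : S n) :
    ν {x} ≤ ((n.multichoose (t / 2) : ℕ) : ℝ≥0∞)⁻¹ := by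
  obtain ⟨⟨hprob, -⟩, hcub⟩ := hν
  obtain ⟨b, hb⟩ := exists_homogeneous_orthonormal hn (t / 2)
  generalize n.multichoose (t / 2) = N at b hb ⊢
  have hK := sum_sq_orthonormal hn b hb x
  -- The kernel at `x`: its value at `x` and its squared L² norm are both `N`.
  let p : homogeneousSubmodule (Fin n) ℝ (t / 2) := ∑ i, polyFun (b i).1 x • b i
  have hp : ∀ y, polyFun p.1 y = ∑ i, polyFun (b i).1 x * polyFun (b i).1 y := by
    intro y
    simp only [p, AddSubmonoidClass.coe_finsetSum, Submodule.coe_smul, polyFun_sum, polyFun_smul]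
  have hpx : polyFun p.1 x = N := by
    rw [hp, ← hK]; simp only [sq]
  have hdeg : (p.1 * p.1).totalDegree ≤ t := by
    have := IsHomogeneous.totalDegree_le (IsHomogeneous.mul p.2 p.2)
    omega
  have h1 : ∫ y, polyFun (p.1 * p.1) y ∂ν = N := by
    rw [hcub _ hdeg, average_sigma, ← hK]
    simp only [polyFun_mul, hp]
    rw [integral_sum_mul_sum _ (fun k => continuous_polyFun (b k).1) hb]
    simp only [sq]
  have h2 : ν.real {x} * (N : ℝ) ^ 2 ≤ ∫ y, polyFun (p.1 * p.1) y ∂ν := by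
    have h3 : ∫ y in {x}, polyFun (p.1 * p.1) y ∂ν ≤ ∫ y, polyFun (p.1 * p.1) y ∂ν :=
      setIntegral_le_integral (integrable_polyFun ν _)
        (Filter.Eventually.of_forall fun y => by
          simp only [polyFun_mul]; exact mul_self_nonneg _)
    rw [integral_singleton, polyFun_mul, hpx] at h3
    simpa [sq] using h3
  rcases Nat.eq_zero_or_pos N with hN | hN
  · simp [hN]
  · have hN' : (0 : ℝ) < N := by exact_mod_cast hN
    have h4 : ν.real {x} ≤ (N : ℝ)⁻¹ := by
      rw [h1] at h2
      rw [← one_div, le_div_iff₀ hN']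
      nlinarith
    rw [← ENNReal.ofReal_natCast, ← ENNReal.ofReal_inv_of_pos hN']
    exact (ENNReal.le_ofReal_iff_toReal_le (measure_ne_top _ _) (by positivity)).2 h4

/-- The points of the countable carrier that are not atoms form a null set, so the atoms cover
everything up to measure zero. -/
lemma one_le_tsum_atoms {n : ℕ} {ν : Measure (S n)} (hν : IsDiscreteProbability ν) :
    1 ≤ ∑' x : {x : S n // ν {x} ≠ 0}, ν {x.1} := by
  obtain ⟨hprob, A, hA, hA0⟩ := hν
  have hsub : {x : S n | ν {x} ≠ 0} ⊆ A := by
    intro x hx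
    by_contra hxA
    exact hx (measure_mono_null (by simpa using hxA) hA0)
  have hT : Countable {x : S n // ν {x} ≠ 0} := (hA.mono hsub).to_subtype
  have hnull : ν (⋃ x ∈ A \ {x : S n | ν {x} ≠ 0}, {x}) = 0 := by
    rw [measure_biUnion_null_iff (hA.mono Set.sdiff_subset)]
    rintro x ⟨-, hx⟩
    simpa using hx
  have hcov : (Set.univ : Set (S n)) ⊆ (⋃ x : {x : S n // ν {x} ≠ 0}, {x.1}) ∪
      (Aᶜ ∪ ⋃ x ∈ A \ {x : S n | ν {x} ≠ 0}, {x}) := by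
    intro x _
    simp only [Set.mem_union, Set.mem_iUnion, Set.mem_compl_iff, Set.mem_sdiff,
      Set.mem_singleton_iff, Set.mem_ofPred_eq]
    by_cases h : ν {x} = 0
    · by_cases hxA : x ∈ A
      · exact Or.inr (Or.inr ⟨x, ⟨hxA, by simpa using h⟩, rfl⟩)
      · exact Or.inr (Or.inl hxA)
    · exact Or.inl ⟨⟨x, h⟩, rfl⟩
  calc (1 : ℝ≥0∞) = ν Set.univ := measure_univ.symm
    _ ≤ _ := measure_mono hcov
    _ ≤ _ := measure_union_le _ _
    _ = ν (⋃ x : {x : S n // ν {x} ≠ 0}, {x.1}) := by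
      rw [measure_union_null hA0 hnull, add_zero]
    _ ≤ _ := measure_iUnion_le _

lemma rpow_le_Theta {t n : ℕ} (hn : 1 ≤ n) {θ : ℝ} (hθ : θ < 1) :
    ((n.multichoose (t / 2) : ℕ) : ℝ≥0∞) ^ (1 - θ) ≤ Theta t θ n := by
  refine le_iInf₂ fun ν hν => ?_
  set N : ℝ≥0∞ := ((n.multichoose (t / 2) : ℕ) : ℝ≥0∞) with hNdef
  have := hν.1.1
  calc N ^ (1 - θ) = N ^ (1 - θ) * 1 := (mul_one _).symm
    _ ≤ N ^ (1 - θ) * ∑' x : {x : S n // ν {x} ≠ 0}, ν {x.1} := by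
      gcongr; exact one_le_tsum_atoms hν.1
    _ = ∑' x : {x : S n // ν {x} ≠ 0}, N ^ (1 - θ) * ν {x.1} := ENNReal.tsum_mul_left.symm
    _ ≤ ∑' x : {x : S n // ν {x} ≠ 0}, (ν {x.1}) ^ θ := by
      refine ENNReal.tsum_le_tsum fun x => ?_
      have h0 : ν {x.1} ≠ 0 := x.2
      have ht : ν {x.1} ≠ ∞ := measure_ne_top _ _
      have h1 : N ≤ (ν {x.1})⁻¹ := by
        rw [ENNReal.le_inv_iff_le_inv]; exact measure_singleton_le hn hν x.1
      calc N ^ (1 - θ) * ν {x.1} ≤ ((ν {x.1})⁻¹) ^ (1 - θ) * ν {x.1} := by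
            gcongr
        _ = (ν {x.1}) ^ (θ - 1) * (ν {x.1}) ^ (1 : ℝ) := by
            rw [ENNReal.inv_rpow, ← ENNReal.rpow_neg, neg_sub, ENNReal.rpow_one]
        _ = (ν {x.1}) ^ θ := by
            rw [← ENNReal.rpow_add _ _ h0 ht]; congr 1; ring

/-- `n.multichoose e` is `n (n + 1) ⋯ (n + e - 1) / e!`; the next lemma uses the symmetric form,
with `n - 1` factors of size at least `e + 1`. -/
lemma pow_div_factorial_le_multichoose {n : ℕ} (hn : 1 ≤ n) (e : ℕ) :
    (n : ℝ) ^ e / e.factorial ≤ n.multichoose e := by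
  obtain ⟨m, rfl⟩ : ∃ m, n = m + 1 := ⟨n - 1, by omega⟩
  rw [div_le_iff₀ (by positivity), Nat.multichoose_eq]
  have h := Nat.pow_succ_le_ascFactorial (m + 1) e
  rw [Nat.ascFactorial_eq_factorial_mul_choose] at h
  have e1 : m + 1 + e - 1 = m + e := by omega
  rw [e1, mul_comm]
  exact_mod_cast h

lemma succ_pow_div_factorial_le_multichoose {n : ℕ} (hn : 1 ≤ n) (e : ℕ) :
    ((e : ℝ) + 1) ^ (n - 1) / (n - 1).factorial ≤ n.multichoose e := by
  obtain ⟨m, rfl⟩ : ∃ m, n = m + 1 := ⟨n - 1, by omega⟩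
  rw [div_le_iff₀ (by positivity), Nat.multichoose_eq]
  have h := Nat.pow_succ_le_ascFactorial (e + 1) m
  rw [Nat.ascFactorial_eq_factorial_mul_choose] at h
  have e1 : m + 1 + e - 1 = m + e := by omega
  rw [e1, mul_comm, Nat.add_sub_cancel, ← Nat.choose_symm_add, add_comm m e]
  exact_mod_cast h

lemma ofReal_rpow_le_Theta {t n : ℕ} (hn : 1 ≤ n) {θ : ℝ} (hθ : θ < 1) {a : ℝ} (ha : 0 ≤ a)
    (h : a ≤ n.multichoose (t / 2)) : ENNReal.ofReal (a ^ (1 - θ)) ≤ Theta t θ n := by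
  refine le_trans ?_ (rpow_le_Theta hn hθ)
  rw [← ENNReal.ofReal_rpow_of_nonneg ha (by linarith), ← ENNReal.ofReal_natCast]
  exact ENNReal.rpow_le_rpow (ENNReal.ofReal_le_ofReal h) (by linarith)

end LowerBound

section FixedDimension

open MvPolynomial

/-! ### Finitely supported measures and reduction to homogeneous polynomials -/

/-- The measure with mass `w i` at the point `x i`. -/
def pointMasses {n : ℕ} {ι : Type*} [Fintype ι] (w : ι → ℝ) (x : ι → S n) : Measure (S n) :=
  ∑ i, ENNReal.ofReal (w i) • Measure.dirac (x i)

lemma integral_pointMasses {n : ℕ} {ι : Type*} [Fintype ι] {w : ι → ℝ} (hw : ∀ i, 0 ≤ w i)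
    (x : ι → S n) {f : S n → ℝ} (hf : Continuous f) :
    ∫ y, f y ∂(pointMasses w x) = ∑ i, w i * f (x i) := by
  unfold pointMasses
  rw [integral_finsetSum_measure fun i _ =>
    (integrable_of_continuous _ hf).smul_measure ENNReal.ofReal_ne_top]
  refine Finset.sum_congr rfl fun i _ => ?_
  rw [integral_smul_measure, integral_dirac, ENNReal.toReal_ofReal (hw i), smul_eq_mul]

lemma isDiscreteProbability_pointMasses {n : ℕ} {ι : Type*} [Fintype ι] {w : ι → ℝ}
    (hw : ∀ i, 0 ≤ w i) (hsum : ∑ i, w i = 1) (x : ι → S n) :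
    IsDiscreteProbability (pointMasses w x) := by
  refine ⟨⟨?_⟩, Set.range x, (Set.finite_range x).countable, ?_⟩
  · simp [pointMasses, ← ENNReal.ofReal_sum_of_nonneg fun i _ => hw i, hsum]
  · simp [pointMasses]

/-- Convexity of `x ↦ x ^ (1 / θ)`; the exponent is meaningless for `θ = 0`, where the sum is just
the cardinality. -/
lemma sum_rpow_le_card_rpow {α : Type*} (s : Finset α) (a : α → ℝ≥0∞) (hs : ∑ i ∈ s, a i ≤ 1)
    {θ : ℝ} (h0 : 0 ≤ θ) (h1 : θ < 1) : ∑ i ∈ s, a i ^ θ ≤ (s.card : ℝ≥0∞) ^ (1 - θ) := by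
  rcases h0.eq_or_lt with rfl | hpos
  · simp
  · have hp : 1 ≤ 1 / θ := by rw [le_div_iff₀ hpos]; linarith
    have h := ENNReal.rpow_sum_le_const_mul_sum_rpow s (fun i => a i ^ θ) hp
    simp only [← ENNReal.rpow_mul, mul_one_div_cancel hpos.ne', ENNReal.rpow_one] at h
    have h' : (∑ i ∈ s, a i ^ θ) ^ (1 / θ) ≤ (s.card : ℝ≥0∞) ^ (1 / θ - 1) :=
      h.trans (by simpa using mul_le_mul_right hs ((s.card : ℝ≥0∞) ^ (1 / θ - 1)))
    have h'' := ENNReal.rpow_le_rpow h' hpos.le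
    rw [← ENNReal.rpow_mul, ← ENNReal.rpow_mul, one_div_mul_cancel hpos.ne',
      ENNReal.rpow_one] at h''
    have e : (1 / θ - 1) * θ = 1 - θ := by field_simp
    rwa [e] at h''

/-- Nodes may coincide and weights may vanish, so the atoms only inject into the image of `x`; this
can only lower the count. -/
lemma thetaNorm_pointMasses_le {n : ℕ} {ι : Type*} [Fintype ι] {w : ι → ℝ}
    (hw : ∀ i, 0 ≤ w i) (hsum : ∑ i, w i = 1) (x : ι → S n) {θ : ℝ} (h0 : 0 ≤ θ) (h1 : θ < 1) :
    thetaNorm θ (pointMasses w x) ≤ (Fintype.card ι : ℝ≥0∞) ^ (1 - θ) := by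
  classical
  have := (isDiscreteProbability_pointMasses hw hsum x).1
  set ν := pointMasses w x with hν
  have hmem : ∀ y, ν {y} ≠ 0 → y ∈ Finset.univ.image x := by
    intro y hy
    by_contra hyx
    apply hy
    simp only [Finset.mem_image, Finset.mem_univ, true_and, not_exists] at hyx
    simp [hν, pointMasses, hyx]
  let F : {y : S n // ν {y} ≠ 0} → Finset.univ.image x := fun y => ⟨y.1, hmem y.1 y.2⟩
  have hF : Function.Injective F := fun a b hab =>
    Subtype.ext (congrArg (fun z : Finset.univ.image x => z.1) hab)
  have hfin : Finite {y : S n // ν {y} ≠ 0} := Finite.of_injective F hF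
  have := Fintype.ofFinite {y : S n // ν {y} ≠ 0}
  unfold thetaNorm
  rw [tsum_fintype]
  refine (sum_rpow_le_card_rpow _ _ ?_ h0 h1).trans ?_
  · have h2 := Finset.sum_map Finset.univ
      (Function.Embedding.subtype fun y => ν {y} ≠ 0) fun y => ν {y}
    rw [sum_measure_singleton] at h2
    exact h2.symm.trans_le prob_le_one
  · refine ENNReal.rpow_le_rpow ?_ (by linarith)
    rw [Finset.card_univ]
    have h2 := Fintype.card_le_of_injective F hF
    rw [Fintype.card_coe] at h2
    exact_mod_cast h2.trans Finset.card_image_le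

lemma Theta_le_of_pointMasses {t n N : ℕ} {ι : Type*} [Fintype ι] {w : ι → ℝ}
    (hw : ∀ i, 0 ≤ w i) (hsum : ∑ i, w i = 1) (x : ι → S n)
    (hcub : pointMasses w x ∈ cubatureMeasures t n) (hN : Fintype.card ι ≤ N)
    {θ : ℝ} (h0 : 0 ≤ θ) (h1 : θ < 1) {a : ℝ} (ha : (N : ℝ) ≤ a) :
    Theta t θ n ≤ ENNReal.ofReal (a ^ (1 - θ)) := by
  refine (iInf₂_le _ hcub).trans ((thetaNorm_pointMasses_le hw hsum x h0 h1).trans ?_)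
  have hN' : (Fintype.card ι : ℝ) ≤ a := le_trans (by exact_mod_cast hN) ha
  rw [← ENNReal.ofReal_rpow_of_nonneg ((Nat.cast_nonneg _).trans hN') (by linarith),
    ← ENNReal.ofReal_natCast]
  exact ENNReal.rpow_le_rpow (ENNReal.ofReal_le_ofReal hN') (by linarith)

/-- The polynomial `∑ i, X i ^ 2`, which is `1` on the sphere. -/
def normSq (n : ℕ) : MvPolynomial (Fin n) ℝ := ∑ i, X i ^ 2

lemma isHomogeneous_normSq (n : ℕ) : (normSq n).IsHomogeneous 2 :=
  IsHomogeneous.sum _ _ _ fun i _ => isHomogeneous_X_pow i 2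

lemma eval_normSq {n : ℕ} (x : EuclideanSpace ℝ (Fin n)) :
    eval (fun i => x i) (normSq n) = ‖x‖ ^ 2 := by
  simp [normSq, EuclideanSpace.norm_sq_eq]

lemma polyFun_normSq {n : ℕ} (x : S n) : polyFun (normSq n) x = 1 := by
  unfold polyFun
  rw [eval_normSq]
  simp

/-- Multiplying by powers of `normSq n`, which is `1` on the sphere, lifts each homogeneous
component to degree `t` or `t - 1`, according to parity. -/
lemma mem_cubatureMeasures_of_homogeneous {t n : ℕ} {ν : Measure (S n)}
    (hν : IsDiscreteProbability ν)
    (h : ∀ s, s ≤ t → t ≤ s + 1 → ∀ p : MvPolynomial (Fin n) ℝ, p.IsHomogeneous s →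
      ∫ x, polyFun p x ∂ν = ∫ x, polyFun p x ∂(mu n)) :
    ν ∈ cubatureMeasures t n := by
  have := hν.1
  refine ⟨hν, fun p hp => ?_⟩
  rw [average_sigma, ← sum_homogeneousComponent p]
  simp only [polyFun_sum]
  rw [integral_finsetSum _ fun i _ => integrable_polyFun _ _,
    integral_finsetSum _ fun i _ => integrable_polyFun _ _]
  refine Finset.sum_congr rfl fun i hi => ?_
  have hi' : i ≤ t := by
    have := Finset.mem_range.1 hi
    omega
  have key := h (i + 2 * ((t - i) / 2)) (by omega) (by omega) _
    ((homogeneousComponent_isHomogeneous i p).mul ((isHomogeneous_normSq n).pow ((t - i) / 2)))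
  have h1 : ∀ x : S n, polyFun (homogeneousComponent i p * normSq n ^ ((t - i) / 2)) x =
      polyFun (homogeneousComponent i p) x := by
    intro x
    have := polyFun_normSq x
    unfold polyFun at this ⊢
    rw [map_mul, map_pow, this, one_pow, mul_one]
  simpa only [h1] using key

lemma integral_polyFun_eq_sum {n : ℕ} (ν : Measure (S n)) [IsFiniteMeasure ν]
    (p : MvPolynomial (Fin n) ℝ) : ∫ x, polyFun p x ∂ν =
      ∑ β ∈ p.support, coeff β p * ∫ x, polyFun (monomial β 1) x ∂ν := by
  have h : ∀ x : S n, polyFun p x = ∑ β ∈ p.support, coeff β p * polyFun (monomial β 1) x := by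
    intro x
    conv_lhs => rw [p.as_sum]
    rw [polyFun_sum]
    refine Finset.sum_congr rfl fun β _ => ?_
    rw [← polyFun_smul, smul_monomial, smul_eq_mul, mul_one]
  simp only [h]
  rw [integral_finsetSum _ fun β _ => (integrable_polyFun _ _).const_mul _]
  simp only [integral_const_mul]

/-! ### The upper bound for a fixed dimension -/

/-- By Carathéodory the hull is a continuous image of a compact set, simplex times a power of `s`.
Shorter combinations are padded with weight zero at a point of `s`. -/
lemma isCompact_convexHull_of_finiteDimensional {E : Type*} [NormedAddCommGroup E]
    [NormedSpace ℝ E] [FiniteDimensional ℝ E] {s : Set E} (hs : IsCompact s) :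
    IsCompact (convexHull ℝ s) := by
  let K : Set ((Fin (Module.finrank ℝ E + 1) → ℝ) × (Fin (Module.finrank ℝ E + 1) → E)) :=
    stdSimplex ℝ (Fin (Module.finrank ℝ E + 1)) ×ˢ Set.pi Set.univ fun _ => s
  have hK : IsCompact K := (isCompact_stdSimplex ℝ _).prod (isCompact_univ_pi fun _ => hs)
  have hcont : Continuous fun y : (Fin (Module.finrank ℝ E + 1) → ℝ) ×
      (Fin (Module.finrank ℝ E + 1) → E) => ∑ i, y.1 i • y.2 i := by fun_prop
  convert hK.image hcont
  apply Set.Subset.antisymm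
  · intro y hy
    obtain ⟨ι, hι, z, w, hz, hind, hw, hsum, heq⟩ := eq_pos_convex_span_of_mem_convexHull hy
    have hcard : Fintype.card ι ≤ Fintype.card (Fin (Module.finrank ℝ E + 1)) := by
      have h1 := hind.card_le_finrank_succ
      have h2 := Submodule.finrank_le (vectorSpan ℝ (Set.range z))
      rw [Fintype.card_fin]
      omega
    obtain ⟨g⟩ := Function.Embedding.nonempty_of_card_le hcard
    have hne : Nonempty ι := by
      by_contra h
      rw [not_nonempty_iff] at h
      simp at hsum
    obtain ⟨i₀⟩ := hne
    refine ⟨(Function.extend g w 0, Function.extend g z fun _ => z i₀), ⟨⟨?_, ?_⟩, ?_⟩, ?_⟩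
    · intro k
      by_cases hk : ∃ i, g i = k
      · obtain ⟨i, rfl⟩ := hk
        simpa [g.injective.extend_apply] using (hw i).le
      · simp [Function.extend_apply' _ _ _ hk]
    · rw [← hsum]
      refine (Fintype.sum_of_injective g g.injective _ _ (fun k hk => ?_) fun i => ?_).symm
      · exact Function.extend_apply' _ _ _ hk
      · exact (g.injective.extend_apply _ _ _).symm
    · intro k _
      by_cases hk : ∃ i, g i = k
      · obtain ⟨i, rfl⟩ := hk
        simpa [g.injective.extend_apply] using hz ⟨i, rfl⟩
      · simpa [Function.extend_apply' _ _ _ hk] using hz ⟨i₀, rfl⟩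
    · rw [← heq]
      refine (Fintype.sum_of_injective g g.injective _ _ (fun k hk => ?_) fun i => ?_).symm
      · have h : Function.extend g w 0 k = 0 := Function.extend_apply' _ _ _ hk
        simp [h]
      · simp [g.injective.extend_apply]
  · rintro _ ⟨⟨w, z⟩, ⟨⟨hw, hsum⟩, hz⟩, rfl⟩
    exact (convex_convexHull ℝ s).sum_mem (fun i _ => hw i) hsum
      fun i _ => subset_convexHull ℝ s (hz i trivial)

/-- A finite family of continuous functions on the sphere has a positive quadrature formula with
at most one more node than there are functions. -/
lemma exists_quadrature {n : ℕ} (hn : 1 ≤ n) {J : Type} [Fintype J] (f : J → S n → ℝ)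
    (hf : ∀ j, Continuous (f j)) : ∃ (ι : Type) (_ : Fintype ι) (w : ι → ℝ) (x : ι → S n),
      (∀ i, 0 ≤ w i) ∧ ∑ i, w i = 1 ∧ (∀ j, ∑ i, w i * f j (x i) = ∫ y, f j y ∂(mu n)) ∧
      Fintype.card ι ≤ Fintype.card J + 1 := by
  have := isProbabilityMeasure_mu hn
  let Φ : S n → J → ℝ := fun y j => f j y
  have hΦ : Continuous Φ := continuous_pi hf
  have hmem : ∫ y, Φ y ∂(mu n) ∈ convexHull ℝ (Set.range Φ) := by
    refine (convex_convexHull ℝ _).integral_mem 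
      (isCompact_convexHull_of_finiteDimensional (isCompact_range hΦ)).isClosed
      (Filter.Eventually.of_forall fun y => subset_convexHull ℝ _ ⟨y, rfl⟩) ?_
    exact hΦ.integrable_of_hasCompactSupport (HasCompactSupport.of_compactSpace _)
  obtain ⟨ι, hι, z, w, hz, hind, hw, hsum, heq⟩ := eq_pos_convex_span_of_mem_convexHull hmem
  have hz' : ∀ i, ∃ y, Φ y = z i := fun i => hz ⟨i, rfl⟩
  choose x hx using hz'
  refine ⟨ι, hι, w, x, fun i => (hw i).le, hsum, fun j => ?_, ?_⟩
  · have h := congrFun heq j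
    rw [eval_integral fun j => integrable_of_continuous _ (hf j)] at h
    rw [← h, Finset.sum_apply]
    refine Finset.sum_congr rfl fun i _ => ?_
    rw [← hx i]
    rfl
  · refine hind.card_le_finrank_succ.trans ?_
    have := Submodule.finrank_le (vectorSpan ℝ (Set.range z))
    rw [Module.finrank_fintype_fun_eq_card] at this
    omega

lemma Theta_le_multichoose {t n : ℕ} (hn : 1 ≤ n) {θ : ℝ} (h0 : 0 ≤ θ) (h1 : θ < 1) {a : ℝ}
    (ha : ((n.multichoose t + n.multichoose (t - 1) + 1 : ℕ) : ℝ) ≤ a) :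
    Theta t θ n ≤ ENNReal.ofReal (a ^ (1 - θ)) := by
  obtain ⟨ι, _, w, x, hw, hsum, hq, hcard⟩ := exists_quadrature hn
    (J := ↥(exponents n t) ⊕ ↥(exponents n (t - 1)))
    (Sum.elim (fun β => polyFun (monomial β.1 1)) (fun β => polyFun (monomial β.1 1)))
    (by rintro (j | j) <;> exact continuous_polyFun _)
  have hd := isDiscreteProbability_pointMasses hw hsum x
  have := hd.1
  refine Theta_le_of_pointMasses hw hsum x ?_ (hcard.trans_eq ?_) h0 h1 ha
  · refine mem_cubatureMeasures_of_homogeneous hd fun s hs hs' p hp => ?_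
    rw [integral_polyFun_eq_sum, integral_polyFun_eq_sum]
    refine Finset.sum_congr rfl fun β hβ => ?_
    rw [integral_pointMasses hw x (continuous_polyFun _)]
    congr 1
    have hdeg := degree_of_mem_support hp hβ
    rcases (show s = t ∨ s = t - 1 by omega) with rfl | rfl
    · exact hq (Sum.inl ⟨β, mem_exponents.2 hdeg⟩)
    · exact hq (Sum.inr ⟨β, mem_exponents.2 hdeg⟩)
  · simp [card_exponents]

lemma multichoose_le_pow {n : ℕ} (hn : 1 ≤ n) {s t : ℕ} (hs : s ≤ t) (ht : 1 ≤ t) :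
    n.multichoose s ≤ (n * t) ^ (n - 1) := by
  obtain ⟨m, rfl⟩ : ∃ m, n = m + 1 := ⟨n - 1, by omega⟩
  have e1 : m + 1 + s - 1 = m + s := by omega
  rw [Nat.multichoose_eq, e1, ← Nat.choose_symm_add, Nat.add_sub_cancel]
  refine (Nat.choose_le_pow _ _).trans (Nat.pow_le_pow_left ?_ _)
  nlinarith

end FixedDimension

section EqualWeights

/-! ### Equal-weight quadrature on the line -/

open Filter Topology

/-- The moment curve `x ↦ (x, x², …, x^d)`. -/
def momentCurve (d : ℕ) (x : ℝ) : Fin d → ℝ := fun j => x ^ (j.1 + 1)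

lemma sum_coeff_momentCurve {d : ℕ} (f : (Fin d → ℝ) →ₗ[ℝ] ℝ) (y : Fin d → ℝ) :
    f y = ∑ j, f (Pi.single j 1) * y j := by
  conv_lhs => rw [← Finset.univ_sum_single y, map_sum]
  refine Finset.sum_congr rfl fun j _ => ?_
  have : (Pi.single j (y j) : Fin d → ℝ) = y j • Pi.single j (1 : ℝ) := by
    rw [← Pi.single_smul, smul_eq_mul, mul_one]
  rw [this, map_smul, smul_eq_mul, mul_comm]

/-- The polynomial whose value at `x` is `a - f (momentCurve d x)`. -/
def curvePoly {d : ℕ} (a : ℝ) (f : (Fin d → ℝ) →ₗ[ℝ] ℝ) : Polynomial ℝ :=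
  Polynomial.C a - ∑ j : Fin d, Polynomial.C (f (Pi.single j 1)) * Polynomial.X ^ (j.1 + 1)

lemma eval_curvePoly {d : ℕ} (a : ℝ) (f : (Fin d → ℝ) →ₗ[ℝ] ℝ) (x : ℝ) :
    (curvePoly a f).eval x = a - f (momentCurve d x) := by
  rw [sum_coeff_momentCurve]
  simp [curvePoly, Polynomial.eval_finsetSum, momentCurve]

lemma eq_zero_of_curvePoly_eq_zero {d : ℕ} {a : ℝ} {f : (Fin d → ℝ) →ₗ[ℝ] ℝ}
    (h : curvePoly a f = 0) : f = 0 := by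
  refine LinearMap.ext fun y => ?_
  rw [sum_coeff_momentCurve]
  refine Finset.sum_eq_zero fun j _ => mul_eq_zero_of_left ?_ _
  have hj := congrArg (fun P => Polynomial.coeff P (j.1 + 1)) h
  simp only [curvePoly, Polynomial.coeff_sub, Polynomial.coeff_C, Polynomial.finsetSum_coeff,
    Polynomial.coeff_C_mul, Polynomial.coeff_X_pow, Polynomial.coeff_zero] at hj
  simpa [Fin.val_inj] using hj

/-- A linear functional that vanishes on the curve is a polynomial vanishing on all of `ℝ`, so the
curve lies in no hyperplane. -/
lemma interior_convexHull_momentCurve_nonempty (d : ℕ) :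
    (interior (convexHull ℝ (Set.range (momentCurve d)))).Nonempty := by
  rw [interior_convexHull_nonempty_iff_affineSpan_eq_top,
    AffineSubspace.affineSpan_eq_top_iff_vectorSpan_eq_top_of_nonempty ℝ _ _ (Set.range_nonempty _),
    vectorSpan_eq_span_vsub_set_right ℝ (Set.mem_range_self (0 : ℝ))]
  by_contra hne
  obtain ⟨f, hf, hle⟩ := Submodule.exists_le_ker_of_lt_top _ (lt_top_iff_ne_top.2 hne)
  apply hf
  have hv : ∀ x, f (momentCurve d x) = 0 := by
    intro x
    have : f (momentCurve d x -ᵥ momentCurve d 0) = 0 :=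
      hle (Submodule.subset_span ⟨_, ⟨x, rfl⟩, rfl⟩)
    have h0 : momentCurve d 0 = 0 := by ext j; simp [momentCurve]
    simpa [h0] using this
  refine eq_zero_of_curvePoly_eq_zero (a := 0) (Polynomial.funext fun x => ?_)
  rw [eval_curvePoly, hv]
  simp

/-- The functional on polynomials with prescribed values on the powers of `X`. -/
def momentFunctional (m : ℕ → ℝ) (P : Polynomial ℝ) : ℝ := P.sum fun j a => a * m j

lemma momentFunctional_curvePoly {d : ℕ} {m : ℕ → ℝ} (h0 : m 0 = 1) (a : ℝ)
    (f : (Fin d → ℝ) →ₗ[ℝ] ℝ) :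
    momentFunctional m (curvePoly a f) = a - f (fun j : Fin d => m (j.1 + 1)) := by
  have hdeg : (curvePoly a f).natDegree < d + 1 := by
    refine Nat.lt_succ_of_le ?_
    unfold curvePoly
    refine (Polynomial.natDegree_sub_le _ _).trans
      (max_le ((Polynomial.natDegree_C a).trans_le (Nat.zero_le d)) ?_)
    refine Polynomial.natDegree_sum_le_of_forall_le _ _ fun j _ => ?_
    exact (Polynomial.natDegree_C_mul_X_pow_le _ _).trans j.2
  rw [momentFunctional, Polynomial.sum_over_range' _ (by simp) (d + 1) hdeg, Finset.sum_range_succ',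
    sum_coeff_momentCurve, ← Fin.sum_univ_eq_sum_range
      (fun j => (curvePoly a f).coeff (j + 1) * m (j + 1))]
  have h1 : (curvePoly a f).coeff 0 = a := by
    simp [curvePoly, Polynomial.coeff_X_pow]
  have h2 : ∀ j : Fin d, (curvePoly a f).coeff (j.1 + 1) = - f (Pi.single j 1) := by
    intro j
    simp [curvePoly, Polynomial.coeff_X_pow, Fin.val_inj]
  simp [h1, h2, h0]
  ring

/-- A functional `f` separating the moment vector `M` from the interior gives a nonzero polynomial
`f M - f (momentCurve d x)` that is nonnegative everywhere but has moment functional `f M - f M =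
0`. -/
lemma mem_interior_convexHull_momentCurve (d : ℕ) {m : ℕ → ℝ} (h0 : m 0 = 1)
    (hpos : ∀ P : Polynomial ℝ, P ≠ 0 → (∀ x, 0 ≤ P.eval x) → 0 < momentFunctional m P) :
    (fun j : Fin d => m (j.1 + 1)) ∈ interior (convexHull ℝ (Set.range (momentCurve d))) := by
  by_contra hmem
  have hne := interior_convexHull_momentCurve_nonempty d
  have hconv := convex_convexHull ℝ (Set.range (momentCurve d))
  obtain ⟨f, hf⟩ := geometric_hahn_banach_open_point hconv.interior isOpen_interior hmem
  set M : Fin d → ℝ := fun j => m (j.1 + 1)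
  have hle : ∀ x, f (momentCurve d x) ≤ f M := by
    intro x
    have hx : momentCurve d x ∈
        closure (interior (convexHull ℝ (Set.range (momentCurve d)))) := by
      rw [hconv.closure_interior_eq_closure_of_nonempty_interior hne]
      exact subset_closure (subset_convexHull ℝ _ ⟨x, rfl⟩)
    have hcl : closure (interior (convexHull ℝ (Set.range (momentCurve d)))) ⊆
        {y | f y ≤ f M} :=
      closure_minimal (fun y hy => (hf y hy).le) (isClosed_le f.continuous continuous_const)
    exact hcl hx
  by_cases hP : curvePoly (f M) (f : (Fin d → ℝ) →ₗ[ℝ] ℝ) = 0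
  · have hf0 := eq_zero_of_curvePoly_eq_zero hP
    obtain ⟨y, hy⟩ := hne
    have h1 : f y = 0 := LinearMap.congr_fun hf0 y
    have h2 : f M = 0 := LinearMap.congr_fun hf0 M
    have := hf y hy
    linarith
  · have := hpos _ hP fun x => by
      rw [eval_curvePoly]
      exact sub_nonneg.2 (hle x)
    rw [momentFunctional_curvePoly h0] at this
    simp [M] at this

/-- A positive quadrature formula for the first `d` moments that has at least `d` nodes. -/
lemma exists_quadrature_line {d : ℕ} (hd : 1 ≤ d) {m : ℕ → ℝ} (h0 : m 0 = 1)
    (hpos : ∀ P : Polynomial ℝ, P ≠ 0 → (∀ x, 0 ≤ P.eval x) → 0 < momentFunctional m P) :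
    ∃ (ι : Type) (_ : Fintype ι) (w x : ι → ℝ) (g : Fin d → ι), (∀ i, 0 ≤ w i) ∧ ∑ i, w i = 1 ∧
      Function.Injective g ∧ Function.Injective (x ∘ g) ∧ (∀ i, 0 < w (g i)) ∧
      ∀ j : Fin d, ∑ i, w i * x i ^ (j.1 + 1) = m (j.1 + 1) := by
  have hint := mem_interior_convexHull_momentCurve d h0 hpos
  set M : Fin d → ℝ := fun j => m (j.1 + 1)
  -- The average of `d` distinct curve points. Moving from `M` slightly away from `y₀` stays in the
  -- hull, so `M` is a convex combination of a hull point and `y₀`, with weights `1 / (1 + ε)` and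
  -- `ε / (1 + ε)`. This forces `d` distinct nodes of positive weight.
  let y₀ : Fin d → ℝ := ∑ i : Fin d, (d : ℝ)⁻¹ • momentCurve d (i.1 : ℝ)
  have hev : ∀ᶠ ε : ℝ in 𝓝 0, M + ε • (M - y₀) ∈ convexHull ℝ (Set.range (momentCurve d)) := by
    have hc : Tendsto (fun ε : ℝ => M + ε • (M - y₀)) (𝓝 0) (𝓝 M) := by
      have : Continuous fun ε : ℝ => M + ε • (M - y₀) := by fun_prop
      simpa using this.tendsto 0
    exact hc (mem_interior_iff_mem_nhds.1 hint)
  obtain ⟨ε, hmem, hε⟩ := ((hev.filter_mono (nhdsWithin_le_nhds (s := Set.Ioi 0))).and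
    self_mem_nhdsWithin).exists
  obtain ⟨κ, hκ, z, w, hz, -, hw, hsum, heq⟩ := eq_pos_convex_span_of_mem_convexHull hmem
  have hz' : ∀ k, ∃ x, momentCurve d x = z k := fun k => hz ⟨k, rfl⟩
  choose x hx using hz'
  have hd' : (0 : ℝ) < d := by exact_mod_cast hd
  refine ⟨κ ⊕ Fin d, inferInstance, Sum.elim (fun k => w k / (1 + ε))
    (fun _ => ε / (1 + ε) * (d : ℝ)⁻¹), Sum.elim x (fun i => (i.1 : ℝ)), Sum.inr, ?_, ?_,
    Sum.inr_injective, ?_, ?_, ?_⟩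
  · rintro (k | i)
    · exact div_nonneg (hw k).le (by positivity)
    · simp only [Sum.elim_inr]; positivity
  · simp only [Fintype.sum_sum_type, Sum.elim_inl, Sum.elim_inr, ← Finset.sum_div, hsum]
    simp
    field_simp
  · intro i j hij
    simpa [Fin.val_inj] using hij
  · intro i
    simp only [Sum.elim_inr]; positivity
  · intro j
    have h1 := congrFun heq j
    simp only [Finset.sum_apply, Pi.smul_apply, ← hx, Pi.add_apply, Pi.sub_apply, y₀, M,
      smul_eq_mul, momentCurve] at h1
    simp only [Fintype.sum_sum_type, Sum.elim_inl, Sum.elim_inr, div_mul_eq_mul_div,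
      ← Finset.sum_div, h1]
    rw [← Finset.mul_sum]
    simp only [mul_assoc, ← Finset.mul_sum]
    field_simp
    ring

/-- The moments as a function of the weights and the nodes. -/
def momentMap (ι : Type) [Fintype ι] (d : ℕ) (y : (ι → ℝ) × (ι → ℝ)) : Fin d → ℝ :=
  fun j => ∑ i, y.1 i * y.2 i ^ (j.1 + 1)

lemma contDiff_momentMap (ι : Type) [Fintype ι] (d : ℕ) : ContDiff ℝ 1 (momentMap ι d) := by
  unfold momentMap
  fun_prop

lemma fderiv_momentMap_apply {ι : Type} [Fintype ι] {d : ℕ} (w x h : ι → ℝ) (j : Fin d) :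
    fderiv ℝ (momentMap ι d) (w, x) (0, h) j =
      ∑ i, w i * (((j.1 + 1 : ℕ) : ℝ) * x i ^ j.1 * h i) := by
  have h1 : HasFDerivAt (momentMap ι d) (fderiv ℝ (momentMap ι d) (w, x)) (w, x) :=
    ((contDiff_momentMap ι d).differentiable one_ne_zero _).hasFDerivAt
  have h2 : HasDerivAt (fun s : ℝ => ((w, x + s • h) : (ι → ℝ) × (ι → ℝ))) (0, h) 0 := by
    refine (hasDerivAt_const _ _).prodMk ?_
    simpa using ((hasDerivAt_id (0 : ℝ)).smul_const h).const_add x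
  have h3 : HasDerivAt (fun s : ℝ => momentMap ι d (w, x + s • h))
      (fderiv ℝ (momentMap ι d) (w, x) (0, h)) 0 := by
    have h1' : HasFDerivAt (momentMap ι d) (fderiv ℝ (momentMap ι d) (w, x))
        (w, x + (0 : ℝ) • h) := by simpa using h1
    exact h1'.comp_hasDerivAt (0 : ℝ) h2
  have h4 := (hasDerivAt_pi.1 h3) j
  have h5 : HasDerivAt (fun s : ℝ => momentMap ι d (w, x + s • h) j)
      (∑ i, w i * (((j.1 + 1 : ℕ) : ℝ) * x i ^ j.1 * h i)) 0 := by
    unfold momentMap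
    refine HasDerivAt.fun_sum fun i _ => HasDerivAt.const_mul _ ?_
    have h6 : HasDerivAt (fun s : ℝ => x i + s * h i) (h i) 0 := by
      simpa using ((hasDerivAt_id (0 : ℝ)).mul_const (h i)).const_add (x i)
    simpa using h6.fun_pow (j.1 + 1)
  exact h4.unique h5

/-- Nodes that keep the moments exist for all weights close to the given ones. -/
lemma eventually_exists_nodes {ι : Type} [Fintype ι] {d : ℕ} {w x : ι → ℝ} {g : Fin d → ι}
    (hg : Function.Injective g) (hx : Function.Injective (x ∘ g)) (hw : ∀ i, 0 < w (g i)) :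
    ∀ᶠ w' in 𝓝 w, ∃ x', momentMap ι d (w', x') = momentMap ι d (w, x) := by
  set T := fderiv ℝ (momentMap ι d) (w, x)
  -- Recording the weights beside the moments turns the claim into local surjectivity, which follows
  -- once the moments are a submersion in the nodes alone.
  have hstrict : HasStrictFDerivAt (fun y => (y.1, momentMap ι d y))
      ((ContinuousLinearMap.fst ℝ (ι → ℝ) (ι → ℝ)).prod T) (w, x) :=
    hasStrictFDerivAt_fst.prodMk
      ((contDiff_momentMap ι d).contDiffAt.hasStrictFDerivAt one_ne_zero)
  have hsurj0 : ∀ b : Fin d → ℝ, ∃ h, T (0, h) = b := by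
    intro b
    -- Up to the factors `j + 1` and the positive weights, the derivative in the `d` chosen nodes is
    -- a transposed Vandermonde matrix.
    have hdet : IsUnit (Matrix.vandermonde (x ∘ g)).transpose := by
      rw [Matrix.isUnit_iff_isUnit_det, Matrix.det_transpose, isUnit_iff_ne_zero]
      exact Matrix.det_vandermonde_ne_zero_iff.2 hx
    obtain ⟨c, hc⟩ := Matrix.mulVec_surjective_iff_isUnit.2 hdet
      (fun j => b j / ((j.1 + 1 : ℕ) : ℝ))
    refine ⟨Function.extend g (fun i => c i / w (g i)) 0, ?_⟩
    ext j
    rw [fderiv_momentMap_apply, ← Fintype.sum_of_injective g hg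
      (fun i => ((j.1 + 1 : ℕ) : ℝ) * (x (g i) ^ j.1 * c i)) _ ?_ ?_]
    · have hj := congrFun hc j
      simp only [Matrix.mulVec, dotProduct, Matrix.transpose_apply, Matrix.vandermonde_apply,
        Function.comp_apply] at hj
      rw [← Finset.mul_sum, hj]
      field_simp
    · intro i hi
      have h : Function.extend g (fun i => c i / w (g i)) 0 i = 0 :=
        Function.extend_apply' _ _ _ hi
      simp [h]
    · intro i
      have h : Function.extend g (fun i => c i / w (g i)) 0 (g i) = c i / w (g i) :=
        hg.extend_apply _ _ _
      have := (hw i).ne'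
      rw [h]
      field_simp
  have hsurj : ((ContinuousLinearMap.fst ℝ (ι → ℝ) (ι → ℝ)).prod T).range = ⊤ := by
    rw [LinearMap.range_eq_top]
    rintro ⟨a, b⟩
    obtain ⟨h, hh⟩ := hsurj0 (b - T (a, 0))
    refine ⟨(a, h), Prod.ext rfl ?_⟩
    have e : ((a, h) : (ι → ℝ) × (ι → ℝ)) = (a, 0) + (0, h) := by simp
    change T (a, h) = b
    rw [e, map_add, hh]
    simp
  have hmap := hstrict.map_nhds_eq_of_surj hsurj
  have hrange : Set.range (fun y => (y.1, momentMap ι d y)) ∈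
      𝓝 ((w, momentMap ι d (w, x)) : (ι → ℝ) × (Fin d → ℝ)) := by
    rw [← hmap]
    exact Filter.range_mem_map
  have hcont : Tendsto (fun w' => (w', momentMap ι d (w, x))) (𝓝 w)
      (𝓝 (w, momentMap ι d (w, x))) :=
    (Continuous.prodMk_left _).tendsto w
  filter_upwards [hcont hrange] with w' hw'
  obtain ⟨⟨a, x'⟩, hax⟩ := hw'
  obtain ⟨h1, h2⟩ := Prod.ext_iff.1 hax
  simp only at h1 h2
  subst h1
  refine ⟨x', ?_⟩
  exact h2

/-- Weights can be approximated by fractions with any large denominator. -/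
lemma eventually_exists_nat_weights {ι : Type} [Fintype ι] {w : ι → ℝ} (hw : ∀ i, 0 ≤ w i)
    (hsum : ∑ i, w i = 1) {U : Set (ι → ℝ)} (hU : U ∈ 𝓝 w) :
    ∀ᶠ p : ℕ in atTop, ∃ a : ι → ℕ, ∑ i, a i = p ∧ (fun i => (a i : ℝ) / p) ∈ U := by
  classical
  obtain ⟨i₀⟩ : Nonempty ι := by
    by_contra h
    rw [not_nonempty_iff] at h
    simp at hsum
  let b : ℕ → ι → ℕ := fun p i => ⌊w i * p⌋₊
  have hb : ∀ p, ∑ i, b p i ≤ p := by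
    intro p
    have : ((∑ i, b p i : ℕ) : ℝ) ≤ p := by
      push_cast
      calc ∑ i, (b p i : ℝ) ≤ ∑ i, w i * p :=
            Finset.sum_le_sum fun i _ => Nat.floor_le (mul_nonneg (hw i) (Nat.cast_nonneg _))
        _ = p := by rw [← Finset.sum_mul, hsum, one_mul]
    exact_mod_cast this
  -- Rounding down loses only `o(p)` in total; the deficit goes to one index.
  let a : ℕ → ι → ℕ := fun p i => b p i + if i = i₀ then p - ∑ i, b p i else 0
  have hlim : ∀ i, Tendsto (fun p : ℕ => (b p i : ℝ) / p) atTop (𝓝 (w i)) := fun i =>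
    (tendsto_nat_floor_mul_div_atTop (hw i)).comp tendsto_natCast_atTop_atTop
  have hlim' : Tendsto (fun p : ℕ => 1 - ∑ i, (b p i : ℝ) / p) atTop (𝓝 0) := by
    have := (tendsto_finsetSum Finset.univ fun i _ => hlim i).const_sub 1
    simpa [hsum] using this
  have ha : Tendsto (fun p : ℕ => fun i => (a p i : ℝ) / p) atTop (𝓝 w) := by
    refine tendsto_pi_nhds.2 fun i => ?_
    have h1 : Tendsto (fun p : ℕ => (b p i : ℝ) / p +
        if i = i₀ then 1 - ∑ i, (b p i : ℝ) / p else 0) atTop (𝓝 (w i)) := by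
      by_cases h : i = i₀
      · simpa [h] using (hlim i₀).add hlim'
      · simpa [h] using hlim i
    refine h1.congr' ?_
    filter_upwards [eventually_gt_atTop 0] with p hp
    have hp' : (p : ℝ) ≠ 0 := by exact_mod_cast hp.ne'
    by_cases h : i = i₀
    · simp only [a, h, if_true]
      rw [Nat.cast_add, Nat.cast_sub (hb p), add_div, sub_div, div_self hp', Nat.cast_sum,
        Finset.sum_div]
    · simp [a, h]
  filter_upwards [ha hU] with p hp
  refine ⟨a p, ?_, hp⟩
  simp only [a, Finset.sum_add_distrib, Finset.sum_ite_eq', Finset.mem_univ, if_true]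
  have := hb p
  omega

/-- An equal-weight quadrature formula with a prime number of nodes. -/
lemma exists_equal_weight_quadrature {d : ℕ} (hd : 1 ≤ d) {m : ℕ → ℝ} (h0 : m 0 = 1)
    (hpos : ∀ P : Polynomial ℝ, P ≠ 0 → (∀ x, 0 ≤ P.eval x) → 0 < momentFunctional m P) :
    ∃ p : ℕ, p.Prime ∧ ∃ φ : Fin p → ℝ, ∀ j ≤ d, ∑ a, φ a ^ j = p * m j := by
  obtain ⟨ι, _, w, x, g, hw, hsum, hg, hx, hwg, hmom⟩ := exists_quadrature_line hd h0 hpos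
  obtain ⟨p₀, hp₀⟩ := eventually_atTop.1
    (eventually_exists_nat_weights hw hsum (eventually_exists_nodes hg hx hwg))
  obtain ⟨p, hpp, hprime⟩ := Nat.exists_infinite_primes p₀
  obtain ⟨a, hap, x', hx'⟩ := hp₀ p hpp
  refine ⟨p, hprime, ?_⟩
  -- Each node `x' i` is repeated `a i` times, which turns the weights `a i / p` into equal ones.
  have hcard : Fintype.card (Fin p) = Fintype.card (Σ i, Fin (a i)) := by simp [hap]
  let e := Fintype.equivOfCardEq hcard
  refine ⟨fun z => x' (e z).1, fun j hj => ?_⟩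
  have hp0 : (p : ℝ) ≠ 0 := by exact_mod_cast hprime.ne_zero
  rw [Equiv.sum_comp e (fun z => x' z.1 ^ j), Fintype.sum_sigma]
  simp only [Finset.sum_const, Finset.card_univ, Fintype.card_fin, nsmul_eq_mul]
  rcases Nat.eq_zero_or_pos j with rfl | hjpos
  · simp only [pow_zero, mul_one, h0]
    exact_mod_cast hap
  · obtain ⟨j', rfl⟩ : ∃ j', j = j' + 1 := ⟨j - 1, by omega⟩
    have h1 := congrFun hx' ⟨j', by omega⟩
    simp only [momentMap] at h1
    have h2 := hmom ⟨j', by omega⟩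
    simp only at h2
    rw [h2] at h1
    rw [← h1, Finset.mul_sum]
    refine Finset.sum_congr rfl fun i _ => ?_
    field_simp

end EqualWeights

section Arrays

/-! ### Orthogonal arrays -/

/-- Double counting of `F (ψ g + h)`: surjectivity makes the sum over `g` independent of `h`. -/
lemma card_mul_sum_comp_surjective {G H : Type*} [AddCommGroup G] [AddCommGroup H] [Fintype G]
    [Fintype H] (ψ : G →+ H) (hψ : Function.Surjective ψ) (F : H → ℝ) :
    (Fintype.card H : ℝ) * ∑ g, F (ψ g) = Fintype.card G * ∑ h, F h := by
  have h1 : ∀ h, ∑ g, F (ψ g + h) = ∑ g, F (ψ g) := by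
    intro h
    obtain ⟨g', rfl⟩ := hψ h
    simpa only [← map_add, Equiv.coe_addRight] using
      Equiv.sum_comp (Equiv.addRight g') fun g => F (ψ g)
  have h2 : ∀ g, ∑ h, F (ψ g + h) = ∑ h, F h := fun g => Equiv.sum_comp (Equiv.addLeft (ψ g)) F
  calc (Fintype.card H : ℝ) * ∑ g, F (ψ g) = ∑ h : H, ∑ g, F (ψ g + h) := by simp [h1]
    _ = ∑ g, ∑ h, F (ψ g + h) := Finset.sum_comm
    _ = _ := by simp [h2]

/-- The row of the array belonging to `(a, b)`: the values of a functional `l` on the polynomial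
`∑ j, b j * X ^ (j + 1)`, shifted by `a`. -/
def arrayRow {F K : Type*} [Field F] [Field K] [Algebra F K] (l : K →ₗ[F] F) (e : ℕ) (I : Type*)
    (α : I → K) : F × (Fin e → K) →+ (I → F) where
  toFun y := fun i => y.1 + l (∑ j, y.2 j * α i ^ (j.1 + 1))
  map_zero' := by ext; simp
  map_add' y z := by
    ext i
    simp only [Prod.fst_add, Prod.snd_add, Pi.add_apply, add_mul, Finset.sum_add_distrib, map_add]
    ring

/-- Lift the targets through `l` and interpolate with degree at most `e`. The constant coefficient
matters only through its image in `F`, so it need not range over `K`; this saves one factor of order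
`n` in the array size. -/
lemma arrayRow_surjective {F K : Type*} [Field F] [Field K] [Algebra F K] {l : K →ₗ[F] F}
    (hl : Function.Surjective l) {e : ℕ} {I : Type*} [Fintype I] {α : I → K}
    (hα : Function.Injective α) (hI : Fintype.card I ≤ e + 1) :
    Function.Surjective (arrayRow l e I α) := by
  classical
  intro y
  choose z hz using fun i => hl (y i)
  let P := Lagrange.interpolate Finset.univ α z
  have hdeg : P.degree < ((e + 1 : ℕ) : WithBot ℕ) := by
    refine (Lagrange.degree_interpolate_lt (s := Finset.univ) (v := α) z hα.injOn).trans_le ?_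
    rw [Finset.card_univ]
    exact_mod_cast hI
  have hnat : P.natDegree < e + 1 := by
    by_cases hP : P = 0
    · simp [hP]
    · exact (Polynomial.natDegree_lt_iff_degree_lt hP).2 hdeg
  refine ⟨(l (P.coeff 0), fun j => P.coeff (j.1 + 1)), ?_⟩
  ext i
  have h1 : P.eval (α i) = z i :=
    Lagrange.eval_interpolate_at_node z hα.injOn (Finset.mem_univ i)
  rw [Polynomial.eval_eq_sum_range' hnat, Finset.sum_range_succ',
    ← Fin.sum_univ_eq_sum_range (fun j => P.coeff (j + 1) * α i ^ (j + 1))] at h1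
  rw [← hz i, ← h1]
  simp [arrayRow, add_comm]

/-- A family of `O(n ^ e)` words of length `n` over an alphabet of prime size `p` in which any
`e + 1` letters are independent and uniformly distributed. -/
lemma exists_orthogonal_array {p : ℕ} (hp : p.Prime) (e : ℕ) {n : ℕ} (hn : 1 ≤ n) :
    ∃ (Ω : Type) (_ : Fintype Ω) (c : Ω → Fin n → Fin p), Nonempty Ω ∧
      Fintype.card Ω ≤ p * (p * n) ^ e ∧
      ∀ I : Finset (Fin n), I.card ≤ e + 1 → ∀ f : Fin n → Fin p → ℝ,
        (p : ℝ) ^ I.card * ∑ ω, ∏ i ∈ I, f i (c ω i) =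
          Fintype.card Ω * ∏ i ∈ I, ∑ a, f i a := by
  have : Fact p.Prime := ⟨hp⟩
  -- This degree gives `n < |K| ≤ p * n`: enough distinct evaluation points at bounded cost.
  let K := GaloisField p (Nat.log p n + 1)
  have : Fintype K := Fintype.ofFinite K
  have hK : Fintype.card K = p ^ (Nat.log p n + 1) := by
    rw [← Nat.card_eq_fintype_card]
    exact GaloisField.card p _ (Nat.succ_ne_zero _)
  obtain ⟨α⟩ : Nonempty (Fin n ↪ K) := by
    refine Function.Embedding.nonempty_of_card_le ?_
    rw [Fintype.card_fin, hK]
    exact (Nat.lt_pow_succ_log_self hp.one_lt n).le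
  obtain ⟨l, hl⟩ : ∃ l : K →ₗ[ZMod p] ZMod p, Function.Surjective l :=
    ⟨Algebra.trace (ZMod p) K, Algebra.trace_surjective (ZMod p) K⟩
  let E : ZMod p ≃ Fin p := Fintype.equivFinOfCardEq (ZMod.card p)
  refine ⟨ZMod p × (Fin e → K), inferInstance, fun ω i => E (arrayRow l e (Fin n) α ω i),
    inferInstance, ?_, ?_⟩
  · rw [Fintype.card_prod, ZMod.card, Fintype.card_fun, Fintype.card_fin, hK, pow_succ, mul_comm p n]
    gcongr
    exact Nat.pow_log_le_self p (by omega)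
  · intro I hI f
    have hsurj : Function.Surjective (arrayRow l e I fun i : I => α i.1) :=
      arrayRow_surjective hl (α.injective.comp Subtype.val_injective) (by simpa using hI)
    have key := card_mul_sum_comp_surjective _ hsurj fun y => ∏ i : I, f i.1 (E (y i))
    rw [Fintype.card_fun, ZMod.card, Fintype.card_coe] at key
    have h1 : ∑ y : I → ZMod p, ∏ i : I, f i.1 (E (y i)) = ∏ i ∈ I, ∑ a, f i a := by
      rw [← Finset.prod_coe_sort I fun i => ∑ a, f i a]
      have h2 : ∀ i : I, ∑ a, f i.1 a = ∑ a, f i.1 (E a) := fun i => (E.sum_comp _).symm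
      simp only [h2]
      rw [Finset.prod_univ_sum, Fintype.piFinset_univ]
    rw [h1] at key
    push_cast at key
    rw [← key]
    congr 1
    refine Finset.sum_congr rfl fun ω _ => ?_
    rw [← Finset.prod_coe_sort I]
    rfl

end Arrays

section Gaussian

open MvPolynomial

/-! ### Gaussian moments -/

lemma integrable_pow_mul_exp_neg_sq (j : ℕ) :
    Integrable fun x : ℝ => x ^ j * Real.exp (-x ^ 2) := by
  have := integrable_rpow_mul_exp_neg_mul_sq (b := 1) one_pos (s := j)
    (by have := (Nat.cast_nonneg j : (0 : ℝ) ≤ j); linarith)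
  simpa using this

lemma integral_exp_neg_sq_pos : 0 < ∫ x : ℝ, Real.exp (-x ^ 2) := by
  have := integral_gaussian 1
  simp only [neg_mul, one_mul, div_one] at this
  rw [this]
  positivity

/-- The `j`-th moment of the probability density proportional to `exp (-x ^ 2)`. -/
def gaussMoment (j : ℕ) : ℝ :=
  (∫ x : ℝ, x ^ j * Real.exp (-x ^ 2)) / ∫ x : ℝ, Real.exp (-x ^ 2)

lemma gaussMoment_zero : gaussMoment 0 = 1 := by
  simp [gaussMoment, div_self integral_exp_neg_sq_pos.ne']

lemma momentFunctional_gaussMoment (P : Polynomial ℝ) : momentFunctional gaussMoment P =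
    (∫ x : ℝ, P.eval x * Real.exp (-x ^ 2)) / ∫ x : ℝ, Real.exp (-x ^ 2) := by
  have h : ∀ x : ℝ, P.eval x * Real.exp (-x ^ 2) =
      ∑ j ∈ P.support, P.coeff j * (x ^ j * Real.exp (-x ^ 2)) := by
    intro x
    rw [Polynomial.eval_eq_sum, Polynomial.sum, Finset.sum_mul]
    exact Finset.sum_congr rfl fun j _ => by ring
  simp only [h]
  rw [integral_finsetSum _ fun j _ => (integrable_pow_mul_exp_neg_sq j).const_mul _]
  simp only [integral_const_mul, momentFunctional, Polynomial.sum, gaussMoment, Finset.sum_div,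
    mul_div_assoc]

lemma integrable_eval_mul_exp_neg_sq (P : Polynomial ℝ) :
    Integrable fun x : ℝ => P.eval x * Real.exp (-x ^ 2) := by
  have h : (fun x : ℝ => P.eval x * Real.exp (-x ^ 2)) = fun x =>
      ∑ j ∈ P.support, P.coeff j * (x ^ j * Real.exp (-x ^ 2)) := by
    funext x
    rw [Polynomial.eval_eq_sum, Polynomial.sum, Finset.sum_mul]
    exact Finset.sum_congr rfl fun j _ => by ring
  rw [h]
  exact integrable_finsetSum _ fun j _ => (integrable_pow_mul_exp_neg_sq j).const_mul _

lemma momentFunctional_gaussMoment_pos {P : Polynomial ℝ} (hP : P ≠ 0)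
    (hnonneg : ∀ x, 0 ≤ P.eval x) : 0 < momentFunctional gaussMoment P := by
  rw [momentFunctional_gaussMoment]
  refine div_pos ?_ integral_exp_neg_sq_pos
  rw [integral_pos_iff_support_of_nonneg
    (fun x => mul_nonneg (hnonneg x) (Real.exp_pos _).le) (integrable_eval_mul_exp_neg_sq P)]
  have hcont : Continuous fun x : ℝ => P.eval x * Real.exp (-x ^ 2) := by fun_prop
  refine hcont.isOpen_support.measure_pos _ ?_
  by_contra hempty
  rw [Set.not_nonempty_iff_eq_empty, Function.support_eq_empty_iff] at hempty
  refine hP (Polynomial.funext fun x => ?_)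
  have := congrFun hempty x
  simpa using this

/-- Polar coordinates for a homogeneous polynomial times a Gaussian. -/
lemma integral_homogeneous_mul_exp {n : ℕ} (hn : 1 ≤ n) (s : ℕ) :
    ∃ R : ℝ, ∀ p : MvPolynomial (Fin n) ℝ, p.IsHomogeneous s →
      ∫ x : EuclideanSpace ℝ (Fin n), eval (fun i => x i) p * Real.exp (-‖x‖ ^ 2) =
        (∫ u, polyFun p u ∂(sigma n)) * R := by
  have := nontrivial_euclideanSpace hn
  refine ⟨∫ r : Set.Ioi (0 : ℝ), r.1 ^ s * Real.exp (-r.1 ^ 2) ∂(Measure.volumeIoiPow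
    (Module.finrank ℝ (EuclideanSpace ℝ (Fin n)) - 1)), fun p hp => ?_⟩
  have h1 := (volume : Measure (EuclideanSpace ℝ (Fin n))).measurePreserving_homeomorphUnitSphereProd
    |>.integral_comp (Homeomorph.measurableEmbedding _)
      (fun y : S n × Set.Ioi (0 : ℝ) => polyFun p y.1 * (y.2.1 ^ s * Real.exp (-y.2.1 ^ 2)))
  rw [integral_prod_mul (fun u : S n => polyFun p u)
    (fun r : Set.Ioi (0 : ℝ) => r.1 ^ s * Real.exp (-r.1 ^ 2))] at h1
  change _ = (∫ u, polyFun p u ∂(sigma n)) * _ at h1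
  have h3 := integral_subtype_comap (μ := volume)
    (measurableSet_singleton (0 : EuclideanSpace ℝ (Fin n))).compl
    fun x : EuclideanSpace ℝ (Fin n) => eval (fun i => x i) p * Real.exp (-‖x‖ ^ 2)
  rw [restrict_compl_singleton] at h3
  rw [← h1, ← h3]
  refine integral_congr_ae (Filter.Eventually.of_forall fun x => ?_)
  simp only [polyFun, homeomorphUnitSphereProd_apply_fst_coe, homeomorphUnitSphereProd_apply_snd_coe]
  have hx : ‖x.1‖ ≠ 0 := norm_ne_zero_iff.2 x.2
  have h2 : (fun i => x.1 i) = fun i => ‖x.1‖ * (‖x.1‖⁻¹ • x.1) i := by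
    funext i
    simp [hx]
  rw [h2, eval_smul_of_isHomogeneous hp]
  ring

lemma eval_monomial_one {n : ℕ} (β : Fin n →₀ ℕ) (x : Fin n → ℝ) :
    eval x (monomial β (1 : ℝ)) = ∏ i, x i ^ β i := by
  rw [eval_monomial, one_mul, Finsupp.prod_fintype _ _ (by simp)]

lemma integral_monomial_mul_exp {n : ℕ} (β : Fin n →₀ ℕ) :
    ∫ x : EuclideanSpace ℝ (Fin n), eval (fun i => x i) (monomial β (1 : ℝ)) *
        Real.exp (-‖x‖ ^ 2) = (∫ x : ℝ, Real.exp (-x ^ 2)) ^ n * ∏ i, gaussMoment (β i) := by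
  have h1 : ∀ x : EuclideanSpace ℝ (Fin n), eval (fun i => x i) (monomial β (1 : ℝ)) *
      Real.exp (-‖x‖ ^ 2) = ∏ i, (x i ^ β i * Real.exp (-x i ^ 2)) := by
    intro x
    rw [eval_monomial_one, EuclideanSpace.norm_sq_eq, Finset.prod_mul_distrib, ← Real.exp_sum]
    simp
  simp only [h1]
  have h2 := (EuclideanSpace.volume_preserving_symm_measurableEquiv_toLp (Fin n)).integral_comp'
    (fun y : Fin n → ℝ => ∏ i, (y i ^ β i * Real.exp (-y i ^ 2)))
  have h3 := integral_fintype_prod_volume_eq_prod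
    (fun (i : Fin n) (x : ℝ) => x ^ β i * Real.exp (-x ^ 2))
  rw [h3] at h2
  refine h2.trans ?_
  have h4 : ∀ i, ∫ x : ℝ, x ^ β i * Real.exp (-x ^ 2) =
      (∫ x : ℝ, Real.exp (-x ^ 2)) * gaussMoment (β i) := by
    intro i
    rw [gaussMoment, mul_div_cancel₀ _ integral_exp_neg_sq_pos.ne']
  simp only [h4, Finset.prod_mul_distrib, Finset.prod_const, Finset.card_univ, Fintype.card_fin]

/-- The Gaussian moments of a fixed even degree are proportional to the moments of the sphere. -/
lemma exists_prod_gaussMoment_eq {n : ℕ} (hn : 1 ≤ n) (k : ℕ) :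
    ∃ κ : ℝ, 0 < κ ∧ ∀ β : Fin n →₀ ℕ, β.degree = 2 * k →
      ∏ i, gaussMoment (β i) = κ * ∫ u, polyFun (monomial β (1 : ℝ)) u ∂(mu n) := by
  obtain ⟨R, hR⟩ := integral_homogeneous_mul_exp hn (2 * k)
  have hZ := pow_pos integral_exp_neg_sq_pos n
  set Z := (∫ x : ℝ, Real.exp (-x ^ 2)) ^ n
  have hσ : ∀ f : S n → ℝ, ∫ u, f u ∂(sigma n) = (sigma n).real Set.univ * ∫ u, f u ∂(mu n) := by
    intro f
    have h0 : (sigma n).real Set.univ ≠ 0 := by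
      have : NeZero (sigma n) := ⟨sigma_ne_zero hn⟩
      exact measureReal_univ_ne_zero
    unfold mu
    rw [integral_smul_measure, ENNReal.toReal_inv, smul_eq_mul, ← mul_assoc]
    change _ = ((sigma n).real Set.univ * ((sigma n).real Set.univ)⁻¹) * _
    rw [mul_inv_cancel₀ h0, one_mul]
  have key : ∀ β : Fin n →₀ ℕ, β.degree = 2 * k → ∏ i, gaussMoment (β i) =
      ((sigma n).real Set.univ * R / Z) * ∫ u, polyFun (monomial β (1 : ℝ)) u ∂(mu n) := by
    intro β hβ
    have h1 := hR _ (isHomogeneous_monomial (1 : ℝ) hβ)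
    rw [integral_monomial_mul_exp, hσ] at h1
    field_simp
    linarith
  refine ⟨_, ?_, key⟩
  -- Testing on an even power of one coordinate shows that the constant is positive.
  have h2 := key (Finsupp.single ⟨0, hn⟩ (2 * k)) (Finsupp.degree_single _ _)
  have h3 : 0 ≤ ∫ u, polyFun (monomial (Finsupp.single (⟨0, hn⟩ : Fin n) (2 * k)) (1 : ℝ)) u
      ∂(mu n) := by
    refine integral_nonneg fun u => ?_
    simp only [polyFun, eval_monomial, Finsupp.prod_single_index, pow_zero, one_mul]
    exact (even_two_mul k).pow_nonneg _
  have h4 : ∀ j, 0 < gaussMoment (2 * j) := by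
    intro j
    have := momentFunctional_gaussMoment_pos (P := Polynomial.X ^ (2 * j))
      (pow_ne_zero _ Polynomial.X_ne_zero)
      (fun x => by rw [Polynomial.eval_pow, Polynomial.eval_X]; exact (even_two_mul j).pow_nonneg x)
    rwa [momentFunctional, ← Polynomial.monomial_one_right_eq_X_pow,
      Polynomial.sum_monomial_index _ _ (by simp), one_mul] at this
  have h5 : 0 < ∏ i, gaussMoment ((Finsupp.single (⟨0, hn⟩ : Fin n) (2 * k)) i) := by
    refine Finset.prod_pos fun i _ => ?_
    by_cases h : (⟨0, hn⟩ : Fin n) = i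
    · rw [Finsupp.single_apply, if_pos h]; exact h4 k
    · rw [Finsupp.single_apply, if_neg h]; exact h4 0
  rw [h2] at h5
  exact pos_of_mul_pos_left h5 h3

end Gaussian

section FixedStrength

open MvPolynomial

/-! ### The upper bound for a fixed strength -/

lemma eval_eq_sum_monomial {n : ℕ} (q : MvPolynomial (Fin n) ℝ) (x : Fin n → ℝ) :
    eval x q = ∑ β ∈ q.support, coeff β q * eval x (monomial β (1 : ℝ)) := by
  conv_lhs => rw [q.as_sum, map_sum]
  refine Finset.sum_congr rfl fun β _ => ?_
  rw [← smul_eval, smul_monomial, smul_eq_mul, mul_one]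

/-- A configuration of `O(n ^ (2 * k - 1))` vectors whose moments of degree `2 * k` are
proportional to those of the sphere. -/
lemma exists_vectors {k : ℕ} (hk : 1 ≤ k) : ∃ p : ℕ, ∀ n : ℕ, 1 ≤ n →
    ∃ (Ω : Type) (_ : Fintype Ω) (x : Ω → EuclideanSpace ℝ (Fin n)) (κ : ℝ), 0 < κ ∧
      Fintype.card Ω ≤ p * (p * n) ^ (2 * k - 1) ∧
      ∀ q : MvPolynomial (Fin n) ℝ, q.IsHomogeneous (2 * k) →
        ∑ ω, eval (fun i => x ω i) q = κ * ∫ u, polyFun q u ∂(mu n) := by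
  obtain ⟨p, hp, φ, hφ⟩ := exists_equal_weight_quadrature (d := 2 * k) (by omega)
    gaussMoment_zero fun P => momentFunctional_gaussMoment_pos
  refine ⟨p, fun n hn => ?_⟩
  obtain ⟨Ω, _, c, hne, hcard, hind⟩ := exists_orthogonal_array hp (2 * k - 1) hn
  obtain ⟨κ, hκ, hmom⟩ := exists_prod_gaussMoment_eq hn k
  have hp0 : (p : ℝ) ≠ 0 := by exact_mod_cast hp.ne_zero
  refine ⟨Ω, inferInstance, fun ω => WithLp.toLp 2 fun i => φ (c ω i), Fintype.card Ω * κ,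
    mul_pos (by exact_mod_cast Fintype.card_pos) hκ, hcard, fun q hq => ?_⟩
  simp only
  have hmon : ∀ β ∈ q.support, ∑ ω, eval (fun i => φ (c ω i)) (monomial β (1 : ℝ)) =
      Fintype.card Ω * κ * ∫ u, polyFun (monomial β (1 : ℝ)) u ∂(mu n) := by
    intro β hβ
    have hdeg := degree_of_mem_support hq hβ
    -- A monomial of degree `2 * k` involves at most `2 * k` variables, exactly the strength of the
    -- array.
    have hsupp : β.support.card ≤ 2 * k - 1 + 1 := by
      have h1 : β.support.card ≤ β.degree := by
        rw [Finsupp.degree_apply, Finset.card_eq_sum_ones]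
        exact Finset.sum_le_sum fun i hi => Nat.one_le_iff_ne_zero.2 (Finsupp.mem_support_iff.1 hi)
      omega
    have h2 := hind β.support hsupp fun i a => φ a ^ β i
    have h3 : ∀ i ∈ β.support, ∑ a, φ a ^ β i = p * gaussMoment (β i) := fun i _ =>
      hφ _ ((Finsupp.le_degree i β).trans hdeg.le)
    rw [Finset.prod_congr rfl h3, Finset.prod_mul_distrib, Finset.prod_const] at h2
    have h4 : ∏ i ∈ β.support, gaussMoment (β i) = ∏ i, gaussMoment (β i) := by
      refine Finset.prod_subset (Finset.subset_univ _) fun i _ hi => ?_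
      rw [Finsupp.notMem_support_iff.1 hi, gaussMoment_zero]
    rw [h4, hmom β hdeg] at h2
    have hpp : (p : ℝ) ^ β.support.card ≠ 0 := pow_ne_zero _ hp0
    have h5 : ∑ ω, ∏ i ∈ β.support, φ (c ω i) ^ β i =
        Fintype.card Ω * κ * ∫ u, polyFun (monomial β (1 : ℝ)) u ∂(mu n) := by
      apply mul_left_cancel₀ hpp
      rw [h2]
      ring
    rw [← h5]
    refine Finset.sum_congr rfl fun ω _ => ?_
    rw [eval_monomial, one_mul, Finsupp.prod]
  rw [integral_polyFun_eq_sum, Finset.mul_sum]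
  simp only [eval_eq_sum_monomial q]
  rw [Finset.sum_comm]
  refine Finset.sum_congr rfl fun β hβ => ?_
  rw [← Finset.mul_sum, hmon β hβ]
  ring

lemma polyFun_neg {n : ℕ} {q : MvPolynomial (Fin n) ℝ} {s : ℕ} (hq : q.IsHomogeneous s)
    (u : S n) : polyFun q (sphereMap (LinearIsometryEquiv.neg ℝ) u) = (-1) ^ s * polyFun q u := by
  unfold polyFun
  rw [← eval_smul_of_isHomogeneous hq]
  simp [sphereMap]

lemma integral_polyFun_odd {n : ℕ} {q : MvPolynomial (Fin n) ℝ} {s : ℕ} (hq : q.IsHomogeneous s)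
    (hs : Odd s) : ∫ u, polyFun q u ∂(mu n) = 0 := by
  have h := integral_comp_sphereMap (LinearIsometryEquiv.neg ℝ) (continuous_polyFun q)
  simp only [polyFun_neg hq, hs.neg_one_pow, neg_one_mul, integral_neg] at h
  linarith

/-- Each vector is replaced by its direction and the antipode, sharing a weight proportional to `‖x‖
^ (2 * k)`. Of the degrees `t` and `t - 1`, one is `2 * k`, handled by `exists_vectors`, and the
other is odd, where antipodes cancel. -/
lemma exists_Theta_le {t : ℕ} (ht : 2 ≤ t) : ∃ C : ℝ, 0 < C ∧ ∀ n : ℕ, 1 ≤ n → ∀ θ : ℝ,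
    0 ≤ θ → θ < 1 → Theta t θ n ≤
      ENNReal.ofReal ((C * (n : ℝ) ^ (2 * (t / 2) - 1)) ^ (1 - θ)) := by
  have hk : 1 ≤ t / 2 := by omega
  generalize hkt : t / 2 = k at hk ⊢
  obtain ⟨p, hp⟩ := exists_vectors hk
  -- The factor `2` counts antipodes; the summand `1` secures positivity.
  refine ⟨2 * p * p ^ (2 * k - 1) + 1, by positivity, fun n hn θ h0 h1 => ?_⟩
  have := isProbabilityMeasure_mu hn
  obtain ⟨Ω, _, x, κ, hκ, hcard, hx⟩ := hp n hn
  choose u hu using fun ω => exists_sphere_smul hn (x ω)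
  have hscale : ∀ q : MvPolynomial (Fin n) ℝ, q.IsHomogeneous (2 * k) → ∀ ω,
      eval (fun i => x ω i) q = ‖x ω‖ ^ (2 * k) * polyFun q (u ω) := by
    intro q hq ω
    unfold polyFun
    rw [← eval_smul_of_isHomogeneous hq]
    congr 2
    funext i
    exact congrArg (fun z : EuclideanSpace ℝ (Fin n) => z i) (hu ω)
  -- Test polynomial `normSq n ^ k`, which is `‖x‖ ^ (2 * k)`.
  have hmass : ∑ ω, ‖x ω‖ ^ (2 * k) = κ := by
    have h := hx (normSq n ^ k) (by simpa [mul_comm] using (isHomogeneous_normSq n).pow k)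
    have h2 : ∀ y : S n, polyFun (normSq n ^ k) y = 1 := by
      intro y
      have := polyFun_normSq y
      unfold polyFun at this ⊢
      rw [map_pow, this, one_pow]
    simpa [h2, eval_normSq, pow_mul] using h
  let w : Ω × Bool → ℝ := fun y => ‖x y.1‖ ^ (2 * k) / (2 * κ)
  let z : Ω × Bool → S n := fun y =>
    if y.2 then u y.1 else sphereMap (LinearIsometryEquiv.neg ℝ) (u y.1)
  have hw : ∀ y, 0 ≤ w y := fun y => by positivity
  have hsum : ∑ y, w y = 1 := by
    simp only [w, Fintype.sum_prod_type, Fintype.sum_bool, ← Finset.sum_div,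
      Finset.sum_add_distrib, hmass]
    field_simp
    norm_num
  have hd := isDiscreteProbability_pointMasses hw hsum z
  refine Theta_le_of_pointMasses hw hsum z ?_ le_rfl h0 h1 ?_
  · refine mem_cubatureMeasures_of_homogeneous hd fun s hs hs' q hq => ?_
    rw [integral_pointMasses hw z (continuous_polyFun q), Fintype.sum_prod_type]
    simp only [Fintype.sum_bool, w, z, if_true, Bool.false_eq_true, if_false, polyFun_neg hq]
    rcases Nat.even_or_odd s with he | ho
    · obtain rfl : s = 2 * k := by
        obtain ⟨r, rfl⟩ := he
        omega
      have h3 := hx q hq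
      simp only [hscale q hq] at h3
      have h4 : ∫ y, polyFun q y ∂(mu n) = (∑ ω, ‖x ω‖ ^ (2 * k) * polyFun q (u ω)) / κ := by
        rw [h3]; field_simp
      rw [h4, Finset.sum_div]
      refine Finset.sum_congr rfl fun ω _ => ?_
      rw [he.neg_one_pow]
      field_simp
      ring
    · rw [integral_polyFun_odd hq ho]
      refine Finset.sum_eq_zero fun ω _ => ?_
      rw [ho.neg_one_pow]
      ring
  · rw [Fintype.card_prod, Fintype.card_bool]
    have h5 : ((Fintype.card Ω : ℕ) : ℝ) ≤ p * (p * n) ^ (2 * k - 1) := by exact_mod_cast hcard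
    have h6 : (0 : ℝ) ≤ (n : ℝ) ^ (2 * k - 1) := by positivity
    rw [mul_pow] at h5
    push_cast
    nlinarith

end FixedStrength

end SphericalCubature

/-! ### Choice of the constants -/

open SphericalCubature in
theorem theorem1p2 :
    (∀ t : ℕ, ∃ c C : ℝ, 0 < c ∧ 0 < C ∧
      ∀ n : ℕ, 1 ≤ n → ∀ θ : ℝ, 0 ≤ θ → θ < 1 →
        ENNReal.ofReal ((c * (n : ℝ) ^ (t / 2)) ^ (1 - θ)) ≤ SphericalCubature.Theta t θ n ∧
        (2 ≤ t → SphericalCubature.Theta t θ n ≤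
          ENNReal.ofReal ((C * (n : ℝ) ^ (2 * (t / 2) - 1)) ^ (1 - θ)))) ∧
    (∀ n : ℕ, 1 ≤ n → ∃ c C : ℝ, 0 < c ∧ 0 < C ∧
      ∀ t : ℕ, 1 ≤ t → ∀ θ : ℝ, 0 ≤ θ → θ < 1 →
        ENNReal.ofReal ((c * (t : ℝ) ^ (n - 1)) ^ (1 - θ)) ≤ SphericalCubature.Theta t θ n ∧
        SphericalCubature.Theta t θ n ≤
          ENNReal.ofReal ((C * (t : ℝ) ^ (n - 1)) ^ (1 - θ))) := by
  refine ⟨fun t => ?_, fun n hn => ?_⟩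
  · have hlower : ∀ n : ℕ, 1 ≤ n → ∀ θ : ℝ, θ < 1 →
        ENNReal.ofReal ((((t / 2).factorial : ℝ)⁻¹ * (n : ℝ) ^ (t / 2)) ^ (1 - θ)) ≤
          Theta t θ n := fun n hn θ hθ =>
      ofReal_rpow_le_Theta hn hθ (by positivity) (by
        rw [inv_mul_eq_div]; exact pow_div_factorial_le_multichoose hn _)
    by_cases ht : 2 ≤ t
    · obtain ⟨C, hC, hup⟩ := exists_Theta_le ht
      exact ⟨_, C, by positivity, hC, fun n hn θ h0 h1 =>
        ⟨hlower n hn θ h1, fun _ => hup n hn θ h0 h1⟩⟩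
    · exact ⟨_, 1, by positivity, one_pos, fun n hn θ h0 h1 =>
        ⟨hlower n hn θ h1, fun h => absurd h ht⟩⟩
  -- The lower constant comes from `t / 2 ≤ ⌊t / 2⌋ + 1`; the `3` counts two spaces of monomials and
  -- the extra Carathéodory node, each contributing at most `(n * t) ^ (n - 1)`.
  · refine ⟨((2 : ℝ) ^ (n - 1))⁻¹ * ((n - 1).factorial : ℝ)⁻¹, 3 * (n : ℝ) ^ (n - 1),
      by positivity, by positivity, fun t ht θ h0 h1 => ⟨?_, ?_⟩⟩
    · refine ofReal_rpow_le_Theta hn h1 (by positivity) ?_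
      refine le_trans ?_ (succ_pow_div_factorial_le_multichoose hn (t / 2))
      have h2 : (t : ℝ) / 2 ≤ ((t / 2 : ℕ) : ℝ) + 1 := by
        have h3 : t ≤ 2 * (t / 2 + 1) := by omega
        have h4 : (t : ℝ) ≤ 2 * (((t / 2 : ℕ) : ℝ) + 1) := by exact_mod_cast h3
        linarith
      calc _ = ((t : ℝ) / 2) ^ (n - 1) / (n - 1).factorial := by
            rw [div_pow]; field_simp
        _ ≤ _ := by gcongr
    · refine Theta_le_multichoose hn h0 h1 ?_
      have h2 := multichoose_le_pow hn (le_refl t) ht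
      have h3 := multichoose_le_pow hn (Nat.sub_le t 1) ht
      have h4 : 1 ≤ (n * t) ^ (n - 1) := Nat.one_le_pow _ _ (Nat.mul_pos hn ht)
      have h5 : n.multichoose t + n.multichoose (t - 1) + 1 ≤ 3 * (n * t) ^ (n - 1) := by omega
      have h6 : ((n.multichoose t + n.multichoose (t - 1) + 1 : ℕ) : ℝ) ≤
          3 * ((n : ℝ) * t) ^ (n - 1) := by exact_mod_cast h5
      rwa [mul_pow, ← mul_assoc] at h6

end
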